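/- Let $G$ be a multivariate regression (MVR) chain graph with finite vertex set $V$: a graph with directed ($\to$) and bidirected ($\leftrightarrow$) edges and without partially directed cycles, i.e. there is no edge $u\to v$ together with a way back from $v$ to $u$ along edges of the form $a\to b$ or $a\leftrightarrow b$. Notation. The chain components of $G$ are the connected components of its bidirected part, $D$ is the directed acyclic graph of the chain components ($T\to T'$ if $u\to v$ in $G$ for some $u\in T$, $v\in T'$), $pa_D(T)$ is the union of the parents of $T$ in $D$, and $nd_D(T)$ is the union of the components $T'\ne T$ to which there is no directed path from $T$ in $D$. For $A\subseteq V$, $an(A)$ is the set of vertices with a directed path (possibly of length $0$) to a vertex of $A$, $pa_G(A)$ is the set of vertices outside $A$ with a directed edge into $A$, and $Nb_G(A)$ is $A$ together with all vertices joined to $A$ by a bidirected edge; $G_A$ is the subgraph induced on $A$, and $A$ is connected if the bidirected part of $G_A$ is connected. A non-endpoint vertex of a path (with distinct vertices) is a collider on it if both edges of the path at this vertex have an arrowhead there. Fix a strict total order $\prec$ of the chain components such that $T\prec T'$ implies that $T$ is not a parent of $T'$ in $D$, and put $pre(T)=\bigcup_{T\prec T'}T'$. Fix also a strict total order $<$ of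 $V$ such that $x<y$ implies $y\notin an(\{x\})$. Let $\Im$ be an independence model on $V$, that is, a set of statements $A\perp\!\!\!\perp B\mid C$ with $A,B,C\subseteq V$ pairwise disjoint and $A,B\neq\emptyset$ (statements in which $A$ or $B$ is empty count as trivially true), and suppose that $\Im$ is a semi-graphoid: for disjoint $A,B,C,D$ it satisfies symmetry ($A\perp\!\!\!\perp B\mid C\Rightarrow B\perp\!\!\!\perp A\mid C$), decomposition ($A\perp\!\!\!\perp B\cup D\mid C\Rightarrow A\perp\!\!\!\perp B\mid C$ and $A\perp\!\!\!\perp D\mid C$), weak union ($A\perp\!\!\!\perp B\cup D\mid C\Rightarrow A\perp\!\!\!\perp B\mid D\cup C$ and $A\perp\!\!\!\perp D\mid B\cup C$) and contraction ($A\perp\!\!\!\perp B\mid D\cup C$ and $A\perp\!\!\!\perp D\mid C$ $\Leftrightarrow$ $A\perp\!\!\!\perp B\cup D\mid C$). Then the following five conditions are equivalent. (i) Global Markov property: $X\perp\!\!\!\perp Y\mid Z$ is in $\Im$ for all pairwise disjoint $X,Y\ne\emptyset$ and $Z$ such that $X$ and $Y$ are m-separated given $Z$, i.e. on every path between a vertex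 of $X$ and a vertex of $Y$ some noncollider is in $Z$ or some collider is not in $an(Z)$. (ii) Global Markov property in the augmented graph: $X\perp\!\!\!\perp Y\mid Z$ is in $\Im$ for all pairwise disjoint $X,Y\neq\emptyset$ and $Z$ such that $Z$ separates $X$ from $Y$ in the augmented graph $(G_{an(X\cup Y\cup Z)})^a$, the undirected graph on the same vertices in which two distinct vertices are adjacent if and only if they are joined in $G_{an(X\cup Y\cup Z)}$ by a path on which every non-endpoint vertex is a collider. (iii) Block-recursive Markov property of type IV: for every chain component $T$, (IV0) $T\perp\!\!\!\perp nd_D(T)\setminus pa_D(T)\mid pa_D(T)$; (IV1) $A\perp\!\!\!\perp pa_D(T)\setminus pa_G(A)\mid pa_G(A)$ for all $A\subseteq T$; (IV2) $A\perp\!\!\!\perp T\setminus Nb_G(A)\mid pa_D(T)$ for all connected $A\subseteq T$. (iv) Multivariate regression Markov property: for every chain component $T$ and all $A\subseteq T$, (MR1) if $A$ is connected, then $A\perp\!\!\!\perp pre(T)\setminus pa_G(A)\mid pa_G(A)$; (MR2) if $A$ is disconnected with connected components $A_1,\dots,A_r$, then $A_1\perp\!\!\!\perp\cdots\perp\!\!\!\perp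 A_r\mid pre(T)$, i.e. $A_i\perp\!\!\!\perp\bigcup_{j\ne i}A_j\mid pre(T)$ for every $i$. (v) Ordered local Markov property: for every vertex $x$ and every $A\subseteq V$ with $an(A)=A$ and $x\in A\subseteq\{v: v<x\text{ or }v=x\}$, $\{x\}\perp\!\!\!\perp A\setminus(mb(x,A)\cup\{x\})\mid mb(x,A)$, where $mb(x,A)=pa_G(dis_{G_A}(x))\cup(dis_{G_A}(x)\setminus\{x\})$ and $dis_{G_A}(x)$ is the connected component of $x$ in the bidirected part of $G_A$. -/

import Mathlib

namespace MVR

universe u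

/-- A mixed graph with directed edges `u → v` (`dir u v`) and bidirected edges `u ↔ v`
(`bi.Adj u v`).  Forgetting the directed edges gives the bidirected graph `bi`. -/
structure MixedGraph (V : Type u) where
  /-- `dir u v` means that there is a directed edge `u → v` -/
  dir : V → V → Prop
  /-- `bi.Adj u v` means that there is a bidirected edge `u ↔ v` -/
  bi : SimpleGraph V

namespace MixedGraph

variable {V : Type u}

/-- A multivariate regression chain graph: there is no partially directed cycle, that is, no
directed edge `u → v` together with a way back from `v` to `u` along edges of the form `a → b` or
`a ↔ b`.  In particular there are no directed cycles, and no two vertices are joined by more than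
one edge. -/
def IsMVRChainGraph (G : MixedGraph V) : Prop :=
  ∀ u v, G.dir u v → ¬ Relation.ReflTransGen (fun a b => G.dir a b ∨ G.bi.Adj a b) v u

/-- Induced subgraph on the vertex set `A`. -/
def induce (G : MixedGraph V) (A : Set V) : MixedGraph A where
  dir := fun u v => G.dir u v
  bi := G.bi.induce A

/-- `G.an X`: the vertices from which there is a directed path, possibly of length zero, to some
vertex of `X`.  As there are no undirected edges, these are also the vertices anterior to `X`. -/
def an (G : MixedGraph V) (X : Set V) : Set V :=
  {a | ∃ b ∈ X, Relation.ReflTransGen G.dir a b}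

/-- `pa_G(A)`: the vertices outside `A` with a directed edge to some vertex of `A`. -/
def pa (G : MixedGraph V) (A : Set V) : Set V :=
  {w | w ∉ A ∧ ∃ v ∈ A, G.dir w v}

/-- `Nb_G(A)`: the set `A` together with all vertices joined to `A` by a bidirected edge. -/
def nb (G : MixedGraph V) (A : Set V) : Set V :=
  A ∪ {w | ∃ v ∈ A, G.bi.Adj w v}

/-! ### Paths, colliders, m-separation -/

/-- Two distinct vertices are adjacent if they are joined by an edge of some type. -/
def skeleton (G : MixedGraph V) : SimpleGraph V where
  Adj u v := u ≠ v ∧ (G.dir u v ∨ G.dir v u ∨ G.bi.Adj u v)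
  symm := ⟨fun _ _ h => ⟨h.1.symm, by
    rcases h.2 with h | h | h
    · exact Or.inr (Or.inl h)
    · exact Or.inl h
    · exact Or.inr (Or.inr h.symm)⟩⟩
  loopless := ⟨fun _ h => h.1 rfl⟩

/-- The edge between `u` and `v` has an arrowhead at `v`.  (In a multivariate regression chain
graph at most one edge joins `u` and `v`.) -/
def ArrowheadAt (G : MixedGraph V) (u v : V) : Prop :=
  G.dir u v ∨ G.bi.Adj u v

/-- The vertex with index `i + 1` of the walk `p` is a collider on `p`: the edges of `p` that
precede and succeed it both have an arrowhead at it.  Only used for `i + 2 ≤ p.length`, where the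
vertex with index `i + 1` is not an endpoint. -/
def IsColliderAt (G : MixedGraph V) {a b : V} (p : G.skeleton.Walk a b) (i : ℕ) : Prop :=
  G.ArrowheadAt (p.getVert i) (p.getVert (i + 1)) ∧
    G.ArrowheadAt (p.getVert (i + 2)) (p.getVert (i + 1))

/-- The path `p` is m-connecting given `Z`: its endpoints and its noncolliders are not in `Z`, and
its colliders are in `an(Z)`. -/
def IsMConnecting (G : MixedGraph V) {a b : V} (p : G.skeleton.Walk a b) (Z : Set V) : Prop :=
  p.IsPath ∧ a ∉ Z ∧ b ∉ Z ∧ ∀ i, i + 2 ≤ p.length →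
    (G.IsColliderAt p i → p.getVert (i + 1) ∈ G.an Z) ∧
    (¬ G.IsColliderAt p i → p.getVert (i + 1) ∉ Z)

/-- `X` and `Y` are m-separated given `Z`. -/
def MSeparated (G : MixedGraph V) (X Y Z : Set V) : Prop :=
  ∀ a ∈ X, ∀ b ∈ Y, ¬ ∃ p : G.skeleton.Walk a b, G.IsMConnecting p Z

/-! ### The augmented graph, m*-separation -/

/-- `x` and `y` are joined by a path on which every nonendpoint vertex is a collider. -/
def ColliderConnected (G : MixedGraph V) (x y : V) : Prop :=
  ∃ p : G.skeleton.Walk x y, p.IsPath ∧ ∀ i, i + 2 ≤ p.length → G.IsColliderAt p i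

theorem ColliderConnected.symm {G : MixedGraph V} {x y : V} (h : G.ColliderConnected x y) :
    G.ColliderConnected y x := by
  obtain ⟨p, hp, hc⟩ := h
  refine ⟨p.reverse, hp.reverse, fun i hi => ?_⟩
  rw [SimpleGraph.Walk.length_reverse] at hi
  obtain ⟨h1, h2⟩ := hc (p.length - (i + 2)) (by omega)
  have e1 : p.length - (i + 2) + 1 = p.length - (i + 1) := by omega
  have e2 : p.length - (i + 2) + 2 = p.length - i := by omega
  rw [e1] at h1 h2
  rw [e2] at h2
  unfold IsColliderAt
  simp only [SimpleGraph.Walk.getVert_reverse]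
  exact ⟨h2, h1⟩

/-- The augmented graph: two distinct vertices are adjacent if and only if they are collider
connected. -/
def augmented (G : MixedGraph V) : SimpleGraph V where
  Adj x y := x ≠ y ∧ G.ColliderConnected x y
  symm := ⟨fun _ _ h => ⟨h.1.symm, h.2.symm⟩⟩
  loopless := ⟨fun _ h => h.1 rfl⟩

end MixedGraph

/-- Separation in an undirected graph: every path from `X` to `Y` meets `Z`. -/
def Separated {W : Type u} (H : SimpleGraph W) (X Y Z : Set W) : Prop :=
  ∀ x ∈ X, ∀ y ∈ Y, ∀ p : H.Walk x y, p.IsPath → ∃ z ∈ p.support, z ∈ Z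

namespace MixedGraph

variable {V : Type u}

/-- `X` and `Y` are m*-separated given `Z`: they are separated by `Z` in the augmented graph of the
subgraph induced on the ancestors of `X ∪ Y ∪ Z`. -/
def MStarSeparated (G : MixedGraph V) (X Y Z : Set V) : Prop :=
  Separated (G.induce (G.an (X ∪ Y ∪ Z))).augmented
    (Subtype.val ⁻¹' X) (Subtype.val ⁻¹' Y) (Subtype.val ⁻¹' Z)

/-! ### Chain components -/

/-- The chain components are the connected components of the bidirected graph. -/
abbrev ChainComponent (G : MixedGraph V) : Type u := G.bi.ConnectedComponent

/-- The directed graph `D` of chain components: `T₁ → T₂` if some `u → v` has `u ∈ T₁`, `v ∈ T₂`. -/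
def compDir (G : MixedGraph V) (T₁ T₂ : G.ChainComponent) : Prop :=
  ∃ u ∈ T₁.supp, ∃ v ∈ T₂.supp, G.dir u v

/-- `pa_D(T)`: the union of the parents of `T` in `D`. -/
def paD (G : MixedGraph V) (T : G.ChainComponent) : Set V :=
  ⋃ T' ∈ {T' : G.ChainComponent | G.compDir T' T}, T'.supp

/-- `nd_D(T)`: the union of the components `T'` to which there is no directed path (possibly of
length zero, so that `T' ≠ T`) from `T` in `D`. -/
def ndD (G : MixedGraph V) (T : G.ChainComponent) : Set V :=
  ⋃ T' ∈ {T' : G.ChainComponent | ¬ Relation.ReflTransGen G.compDir T T'}, T'.supp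

/-- A strict total order of the chain components such that `T ≺ T'` implies that `T` is not a
parent of `T'` in `D`; so parents are larger than their children. -/
structure IsConsistentCompOrder (G : MixedGraph V)
    (lt : G.ChainComponent → G.ChainComponent → Prop) : Prop where
  isStrictTotalOrder : IsStrictTotalOrder G.ChainComponent lt
  consistent : ∀ T T', lt T T' → ¬ G.compDir T T'

/-- `pre(T)`: the union of all components `T'` with `T ≺ T'`, the past of `T`. -/
def pre (G : MixedGraph V) (lt : G.ChainComponent → G.ChainComponent → Prop)
    (T : G.ChainComponent) : Set V :=
  ⋃ T' ∈ {T' : G.ChainComponent | lt T T'}, T'.supp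

/-- A set of vertices is connected if the bidirected graph induced on it is connected. -/
def ConnectedSet (G : MixedGraph V) (A : Set V) : Prop :=
  (G.bi.induce A).Connected

/-- The vertex set of a connected component of the bidirected graph induced on `A`. -/
def compSet (G : MixedGraph V) (A : Set V) (c : (G.bi.induce A).ConnectedComponent) : Set V :=
  Subtype.val '' c.supp

/-! ### Vertex orders and Markov blankets -/

/-- A strict total order of the vertices such that `x ≺ y` implies `y ∉ an(x)`. -/
structure IsConsistentVertexOrder (G : MixedGraph V) (lt : V → V → Prop) : Prop where
  isStrictTotalOrder : IsStrictTotalOrder V lt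
  consistent : ∀ x y, lt x y → y ∉ G.an {x}

/-- Ancestrally closed sets. -/
def AncestrallyClosed (G : MixedGraph V) (A : Set V) : Prop := G.an A = A

/-- The district of `x` in the subgraph induced on `A`: the vertices of `A` that are joined to `x`
by a path of bidirected edges in `A`. -/
def district (G : MixedGraph V) (A : Set V) (x : A) : Set V :=
  Subtype.val '' {y : A | (G.induce A).bi.Reachable x y}

/-- The Markov blanket of `x` with respect to the subgraph induced on `A`. -/
def mb (G : MixedGraph V) (A : Set V) (x : A) : Set V :=
  G.pa (G.district A x) ∪ (G.district A x \ {(x : V)})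

end MixedGraph

/-! ### Independence models -/

/-- An independence model: `I A B C` means `A ⫫ B | C`.  Only its values on triples of pairwise
disjoint sets with `A` and `B` nonempty are ever used. -/
abbrev IndependenceModel (V : Type u) := Set V → Set V → Set V → Prop

variable {V : Type u}

/-- Semi-graphoids.  `A`, `B`, `C`, `D` are disjoint, and only the conditioning set `C` may be
empty. -/
structure IsSemiGraphoid (I : IndependenceModel V) : Prop where
  symmetry : ∀ A B C : Set V, A.Nonempty → B.Nonempty →
    Disjoint A B → Disjoint A C → Disjoint B C → I A B C → I B A C
  decomposition : ∀ A B C D : Set V, A.Nonempty → B.Nonempty → D.Nonempty →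
    Disjoint A B → Disjoint A C → Disjoint A D → Disjoint B C → Disjoint B D → Disjoint C D →
    I A (B ∪ D) C → I A B C ∧ I A D C
  weakUnion : ∀ A B C D : Set V, A.Nonempty → B.Nonempty → D.Nonempty →
    Disjoint A B → Disjoint A C → Disjoint A D → Disjoint B C → Disjoint B D → Disjoint C D →
    I A (B ∪ D) C → I A B (D ∪ C) ∧ I A D (B ∪ C)
  contraction : ∀ A B C D : Set V, A.Nonempty → B.Nonempty → D.Nonempty →
    Disjoint A B → Disjoint A C → Disjoint A D → Disjoint B C → Disjoint B D → Disjoint C D →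
    ((I A B (D ∪ C) ∧ I A D C) ↔ I A (B ∪ D) C)

/-- The independence statement `A ⫫ B | C`, which is trivially true if `A` or `B` is empty. -/
def Indep (I : IndependenceModel V) (A B C : Set V) : Prop :=
  A.Nonempty → B.Nonempty → I A B C

/-- Joint independence `A₁ ⫫ ⋯ ⫫ Aᵣ | C`: each set is independent of the union of the others. -/
def MutuallyIndep (I : IndependenceModel V) {ι : Type u} (A : ι → Set V) (C : Set V) : Prop :=
  ∀ i, Indep I (A i) (⋃ j ∈ {j | j ≠ i}, A j) C

/-! ### The five Markov properties -/

/-- Global Markov property (m-separation). -/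
def GlobalMarkov (G : MixedGraph V) (I : IndependenceModel V) : Prop :=
  ∀ X Y Z : Set V, X.Nonempty → Y.Nonempty → Disjoint X Y → Disjoint X Z → Disjoint Y Z →
    G.MSeparated X Y Z → I X Y Z

/-- Global Markov property (m*-separation in the augmented graph). -/
def AugmentedGlobalMarkov (G : MixedGraph V) (I : IndependenceModel V) : Prop :=
  ∀ X Y Z : Set V, X.Nonempty → Y.Nonempty → Disjoint X Y → Disjoint X Z → Disjoint Y Z →
    G.MStarSeparated X Y Z → I X Y Z

/-- Block-recursive Markov property of type IV. -/
structure BlockRecursiveMarkov (G : MixedGraph V) (I : IndependenceModel V) : Prop where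
  iv0 : ∀ T : G.ChainComponent, Indep I T.supp (G.ndD T \ G.paD T) (G.paD T)
  iv1 : ∀ T : G.ChainComponent, ∀ A ⊆ T.supp, Indep I A (G.paD T \ G.pa A) (G.pa A)
  iv2 : ∀ T : G.ChainComponent, ∀ A ⊆ T.supp, G.ConnectedSet A →
    Indep I A (T.supp \ G.nb A) (G.paD T)

/-- Multivariate regression Markov property, for a given order of the chain components. -/
structure MRMarkov (G : MixedGraph V) (lt : G.ChainComponent → G.ChainComponent → Prop)
    (I : IndependenceModel V) : Prop where
  mr1 : ∀ T : G.ChainComponent, ∀ A ⊆ T.supp, G.ConnectedSet A →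
    Indep I A (G.pre lt T \ G.pa A) (G.pa A)
  mr2 : ∀ T : G.ChainComponent, ∀ A ⊆ T.supp, ¬ G.ConnectedSet A →
    MutuallyIndep I (G.compSet A) (G.pre lt T)

/-- Ordered local Markov property, for a given order of the vertices: for every vertex `x` and
every ancestrally closed set `A` with `x ∈ A` all of whose other elements precede `x`. -/
def OrderedLocalMarkov (G : MixedGraph V) (lt : V → V → Prop) (I : IndependenceModel V) : Prop :=
  ∀ (A : Set V) (x : A), G.AncestrallyClosed A → A ⊆ {v | lt v x ∨ v = x} →
    Indep I {(x : V)} (A \ (G.mb A x ∪ {(x : V)})) (G.mb A x)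

end MVR

namespace MVR

universe u

variable {V : Type u}

/-! ### Semi-graphoid rules for possibly empty sets -/

namespace Indep

variable {I : IndependenceModel V} {A B C D : Set V}

/-! Everything passes through one intermediate statement, `PartitionMarkov`, which concerns only
ancestrally closed sets cut into three parts X, Y, Z. Two vertices are linked if each lies in, or is
a parent of, one common district.

This property follows by induction from very few local independences (`partitionMarkov_of_local`).
Delete a childless vertex x that is independent of the rest given its Markov blanket. If x is in X
or Y, contraction restores it. If x is in Z, its blanket cannot meet both X and Y, because any two
members of the blanket are linked through the district of x; so x is independent of X or of Y given
the rest, contraction adds x to that side, and weak union moves it into the condition. The ordered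
local property supplies x as the last vertex of the set. The two block properties supply any x in
the least chain component that meets the set (`partitionMarkov_of_block`).

Conversely, the block statements are instances of the partition property up to decomposition
(`PartitionMarkov.indep_block`). For the global properties, enlarge X to everything reachable by
links that avoid Z inside an(X ∪ Y ∪ Z). If this closure misses Y, the partition property applies to
it and decomposition finishes (`PartitionMarkov.indep_of_disjoint_linkClosure`). Links between
distinct vertices give edges of the augmented graph, which settles m*-separation. For m-separation,
a chain of links is turned into an open walk (`Passable.of_colliderLinked`) and then into a path.
Finally, both global properties give the ordered local one, since the blanket of a childless vertex
separates it from the rest in either sense. -/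

theorem symm (hI : IsSemiGraphoid I) (hAB : Disjoint A B) (hAC : Disjoint A C)
    (hBC : Disjoint B C) (h : Indep I A B C) : Indep I B A C := fun hB hA =>
  hI.symmetry A B C hA hB hAB hAC hBC (h hA hB)

theorem weakUnion (hI : IsSemiGraphoid I) (hAB : Disjoint A B) (hAC : Disjoint A C)
    (hAD : Disjoint A D) (hBC : Disjoint B C) (hBD : Disjoint B D) (hCD : Disjoint C D)
    (h : Indep I A (B ∪ D) C) : Indep I A B (D ∪ C) := fun hA hB => by
  rcases D.eq_empty_or_nonempty with rfl | hD
  · simpa using h hA (by simpa using hB)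
  · exact (hI.weakUnion A B C D hA hB hD hAB hAC hAD hBC hBD hCD (h hA (hB.mono (by simp)))).1

/-- The axiom requires nonempty sets; if `B` or `D` is empty, one of the two hypotheses is already
the conclusion. -/
theorem contraction (hI : IsSemiGraphoid I) (hAB : Disjoint A B) (hAC : Disjoint A C)
    (hAD : Disjoint A D) (hBC : Disjoint B C) (hBD : Disjoint B D) (hCD : Disjoint C D)
    (h₁ : Indep I A B (D ∪ C)) (h₂ : Indep I A D C) : Indep I A (B ∪ D) C := fun hA hBD' => by
  rcases D.eq_empty_or_nonempty with rfl | hD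
  · simpa using h₁ hA (by simpa using hBD')
  rcases B.eq_empty_or_nonempty with rfl | hB
  · simpa using h₂ hA hD
  · exact (hI.contraction A B C D hA hB hD hAB hAC hAD hBC hBD hCD).1 ⟨h₁ hA hB, h₂ hA hD⟩

theorem mono_right (hI : IsSemiGraphoid I) (hAB : Disjoint A B) (hAC : Disjoint A C)
    (hBC : Disjoint B C) (hDB : D ⊆ B) (h : Indep I A B C) : Indep I A D C := fun hA hD => by
  rcases (B \ D).eq_empty_or_nonempty with hE | hE
  · obtain rfl : D = B := hDB.antisymm (Set.sdiff_eq_empty.1 hE)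
    exact h hA hD
  · have hu : D ∪ B \ D = B := Set.union_sdiff_cancel hDB
    refine (hI.decomposition A D C (B \ D) hA hD hE (hAB.mono_right hDB) hAC
      (hAB.mono_right Set.sdiff_subset) (hBC.mono_left hDB) Set.disjoint_sdiff_right
      (hBC.symm.mono_right Set.sdiff_subset) ?_).1
    rw [hu]
    exact h hA (hD.mono hDB)

theorem mono_left (hI : IsSemiGraphoid I) (hAB : Disjoint A B) (hAC : Disjoint A C)
    (hBC : Disjoint B C) (hDA : D ⊆ A) (h : Indep I A B C) : Indep I D B C :=
  ((h.symm hI hAB hAC hBC).mono_right hI hAB.symm hBC hAC hDA).symm hI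
    (hAB.symm.mono_right hDA) hBC (hAC.mono_left hDA)

end Indep

/-! ### Districts, collider links and Markov blankets -/

namespace MixedGraph

/-- Two vertices of `A` joined by a bidirected edge. -/
def BiStep (G : MixedGraph V) (A : Set V) (s t : V) : Prop :=
  s ∈ A ∧ t ∈ A ∧ G.bi.Adj s t

/-- The vertices reachable from `x` by bidirected edges within `A`. -/
def biDistrict (G : MixedGraph V) (A : Set V) (x : V) : Set V :=
  {y | Relation.ReflTransGen (G.BiStep A) x y}

/-- `u` and `v` both belong to, or are parents of, one district of the subgraph induced on `A`. -/
def ColliderLinked (G : MixedGraph V) (A : Set V) (u v : V) : Prop :=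
  ∃ a ∈ A, ∃ b ∈ G.biDistrict A a, (u = a ∨ G.dir u a) ∧ (v = b ∨ G.dir v b)

/-- The Markov blanket in terms of `biDistrict`. -/
def blanket (G : MixedGraph V) (A : Set V) (x : V) : Set V :=
  G.pa (G.biDistrict A x) ∪ (G.biDistrict A x \ {x})

variable {G : MixedGraph V} {A B : Set V} {a b u v x y : V}

theorem BiStep.symm (h : G.BiStep A u v) : G.BiStep A v u := ⟨h.2.1, h.1, h.2.2.symm⟩

theorem mem_biDistrict_self : x ∈ G.biDistrict A x := Relation.ReflTransGen.refl

theorem mem_biDistrict_symm (h : y ∈ G.biDistrict A x) : x ∈ G.biDistrict A y :=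
  by
  induction h with
  | refl => exact .refl
  | tail _ h ih => exact .head h.symm ih

theorem mem_biDistrict_trans (h : y ∈ G.biDistrict A x) (h' : v ∈ G.biDistrict A y) :
    v ∈ G.biDistrict A x :=
  Relation.ReflTransGen.trans h h'

theorem biDistrict_subset (hx : x ∈ A) : G.biDistrict A x ⊆ A := fun y hy => by
  induction hy with
  | refl => exact hx
  | tail _ h _ => exact h.2.1

theorem biDistrict_mono (h : A ⊆ B) : G.biDistrict A x ⊆ G.biDistrict B x := fun _ hy =>
  Relation.ReflTransGen.mono (fun _ _ hs => ⟨h hs.1, h hs.2.1, hs.2.2⟩) _ _ hy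

theorem reachable_of_mem_biDistrict (h : y ∈ G.biDistrict A x) : G.bi.Reachable x y :=
  (SimpleGraph.reachable_iff_reflTransGen _ _).2
    (Relation.ReflTransGen.mono (fun _ _ hs => hs.2.2) _ _ h)

/-- Bridge to reachability in the induced graph. `biDistrict` lives in `V` itself, so that districts
of different vertex sets can be compared without coercions. -/
theorem mem_biDistrict_iff_reachable {x y : A} :
    (y : V) ∈ G.biDistrict A x ↔ (G.bi.induce A).Reachable x y := by
  rw [SimpleGraph.reachable_iff_reflTransGen]
  constructor
  · intro h
    have key : ∀ z, z ∈ G.biDistrict A x → ∃ hz : z ∈ A,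
        Relation.ReflTransGen (G.bi.induce A).Adj x ⟨z, hz⟩ := by
      intro z hz
      induction hz with
      | refl => exact ⟨x.2, .refl⟩
      | tail _ h ih => exact ⟨h.2.1, ih.2.tail (by simpa using h.2.2)⟩
    exact (key y h).2
  · exact Relation.ReflTransGen.lift (p := G.BiStep A) Subtype.val
      (fun s t h => ⟨s.2, t.2, by simpa using h⟩) x y

theorem district_eq_biDistrict (x : A) : G.district A x = G.biDistrict A x := by
  ext y
  simp only [district, Set.mem_image, Set.mem_ofPred_eq, Subtype.exists, exists_and_right,
    exists_eq_right]
  constructor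
  · rintro ⟨hy, h⟩
    exact mem_biDistrict_iff_reachable.2 h
  · intro h
    have hy := biDistrict_subset x.2 h
    exact ⟨hy, (mem_biDistrict_iff_reachable (y := ⟨y, hy⟩)).1 h⟩

theorem mb_eq_blanket (x : A) : G.mb A x = G.blanket A x := by
  rw [mb, blanket, district_eq_biDistrict]

theorem connectedSet_biDistrict : G.ConnectedSet (G.biDistrict A x) := by
  refine (SimpleGraph.connected_iff_exists_forall_reachable _).2
    ⟨⟨x, mem_biDistrict_self⟩, fun ⟨y, hy⟩ => ?_⟩
  induction hy with
  | refl => exact .refl _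
  | tail h h' ih => exact ih.trans (SimpleGraph.Adj.reachable (by simpa using h'.2.2))

theorem ancestrallyClosed_iff : G.AncestrallyClosed A ↔ ∀ u v, G.dir u v → v ∈ A → u ∈ A := by
  constructor
  · intro h u v huv hv
    rw [← show G.an A = A from h]
    exact ⟨v, hv, .single huv⟩
  · intro h
    refine Set.Subset.antisymm ?_ fun v hv => ⟨v, hv, .refl⟩
    rintro u ⟨v, hv, huv⟩
    induction huv using Relation.ReflTransGen.head_induction_on with
    | refl => exact hv
    | head h' _ ih => exact h _ _ h' ih

theorem ancestrallyClosed_an : G.AncestrallyClosed (G.an A) :=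
  ancestrallyClosed_iff.2 fun _ _ huv ⟨w, hw, hvw⟩ => ⟨w, hw, hvw.head huv⟩

theorem subset_an : A ⊆ G.an A := fun v hv => ⟨v, hv, .refl⟩

theorem blanket_subset (hA : G.AncestrallyClosed A) (hx : x ∈ A) : G.blanket A x ⊆ A := by
  rintro y (⟨_, v, hv, hyv⟩ | ⟨hy, _⟩)
  · exact ancestrallyClosed_iff.1 hA _ _ hyv (biDistrict_subset hx hv)
  · exact biDistrict_subset hx hy

theorem ColliderLinked.mono (h : A ⊆ B) (huv : G.ColliderLinked A u v) :
    G.ColliderLinked B u v := by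
  obtain ⟨a, ha, b, hb, h₁, h₂⟩ := huv
  exact ⟨a, h ha, b, biDistrict_mono h hb, h₁, h₂⟩

theorem ColliderLinked.symm (huv : G.ColliderLinked A u v) : G.ColliderLinked A v u := by
  obtain ⟨a, ha, b, hb, h₁, h₂⟩ := huv
  exact ⟨b, biDistrict_subset ha hb, a, mem_biDistrict_symm hb, h₂, h₁⟩

theorem exists_eq_or_dir_of_mem_blanket (hu : u ∈ G.blanket A x) :
    ∃ a ∈ G.biDistrict A x, u = a ∨ G.dir u a := by
  rcases hu with ⟨_, v, hv, huv⟩ | ⟨hu, _⟩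
  · exact ⟨v, hv, .inr huv⟩
  · exact ⟨u, hu, .inl rfl⟩

theorem colliderLinked_of_mem_blanket (hx : x ∈ A) (hu : u ∈ G.blanket A x) :
    G.ColliderLinked A x u := by
  obtain ⟨a, ha, h⟩ := exists_eq_or_dir_of_mem_blanket hu
  exact ⟨x, hx, a, ha, .inl rfl, h⟩

/-- Both vertices are attached to the district of `x`. Hence a blanket cannot meet both sides of a
separated partition. -/
theorem colliderLinked_of_mem_blanket_of_mem_blanket (hx : x ∈ A) (hu : u ∈ G.blanket A x)
    (hv : v ∈ G.blanket A x) : G.ColliderLinked A u v := by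
  obtain ⟨a, ha, h⟩ := exists_eq_or_dir_of_mem_blanket hu
  obtain ⟨b, hb, h'⟩ := exists_eq_or_dir_of_mem_blanket hv
  exact ⟨a, biDistrict_subset hx ha, b, mem_biDistrict_trans (mem_biDistrict_symm ha) hb, h, h'⟩

theorem notMem_blanket_self : x ∉ G.blanket A x := by
  rintro (h | h)
  · exact h.1 mem_biDistrict_self
  · exact h.2 rfl

theorem IsMVRChainGraph.not_reachable (hG : G.IsMVRChainGraph) (h : G.dir u v) :
    ¬ G.bi.Reachable u v := fun hr =>
  hG u v h (Relation.ReflTransGen.mono (fun _ _ => Or.inr) _ _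
    ((SimpleGraph.reachable_iff_reflTransGen _ _).1 hr.symm))

end MixedGraph

/-! ### The partition Markov property and its local criterion -/

/-- The Markov property for partitions of ancestrally closed sets: if no vertex of `X` is collider
linked to a vertex of `Y` in the ancestrally closed set `X ∪ Y ∪ Z`, then `X ⫫ Y | Z`. -/
def PartitionMarkov (G : MixedGraph V) (I : IndependenceModel V) : Prop :=
  ∀ X Y Z : Set V, G.AncestrallyClosed (X ∪ Y ∪ Z) → Disjoint X Y → Disjoint X Z → Disjoint Y Z →
    (∀ u ∈ X, ∀ v ∈ Y, ¬ G.ColliderLinked (X ∪ Y ∪ Z) u v) → Indep I X Y Z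

variable {G : MixedGraph V} {I : IndependenceModel V}

/-- Split the vertices outside the blanket into `Y` and the rest; weak union moves the rest into the
condition. -/
theorem indep_singleton_of_disjoint_blanket (hI : IsSemiGraphoid I) {A Y : Set V} {x : V}
    (hA : G.AncestrallyClosed A) (hx : x ∈ A)
    (h : Indep I {x} (A \ (G.blanket A x ∪ {x})) (G.blanket A x)) (hY : Y ⊆ A) (hxY : x ∉ Y)
    (hd : Disjoint Y (G.blanket A x)) : Indep I {x} Y (A \ (Y ∪ {x})) := by
  have hb := G.blanket_subset hA hx
  have hxb := G.notMem_blanket_self (A := A) (x := x)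
  have e₁ : A \ (G.blanket A x ∪ {x}) = Y ∪ A \ (G.blanket A x ∪ {x} ∪ Y) := by
    ext v
    have := @hY v
    have := @hb v
    have : v ∈ Y → v ∉ G.blanket A x := fun h => Set.disjoint_left.1 hd h
    simp only [Set.mem_union, Set.mem_sdiff, Set.mem_singleton_iff]; grind
  have e₂ : A \ (Y ∪ {x}) = A \ (G.blanket A x ∪ {x} ∪ Y) ∪ G.blanket A x := by
    ext v
    have := @hY v
    have := @hb v
    have : v ∈ Y → v ∉ G.blanket A x := fun h => Set.disjoint_left.1 hd h
    simp only [Set.mem_union, Set.mem_sdiff, Set.mem_singleton_iff]; grind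
  rw [e₁] at h
  rw [e₂]
  refine h.weakUnion hI (by simpa) (by simpa) (by simp) hd ?_ ?_ <;>
    · rw [Set.disjoint_left]; intro v; simp; tauto

/-- The partition Markov property follows from the local statements for one childless vertex in
each ancestrally closed set. -/
theorem partitionMarkov_of_local [Finite V] (hI : IsSemiGraphoid I)
    (H : ∀ A : Set V, G.AncestrallyClosed A → A.Nonempty → ∃ x ∈ A, (∀ y ∈ A, ¬ G.dir x y) ∧
      Indep I {x} (A \ (G.blanket A x ∪ {x})) (G.blanket A x)) : PartitionMarkov G I := by
  suffices key : ∀ n : ℕ, ∀ X Y Z : Set V, (X ∪ Y ∪ Z).ncard = n →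
      G.AncestrallyClosed (X ∪ Y ∪ Z) → Disjoint X Y → Disjoint X Z → Disjoint Y Z →
      (∀ u ∈ X, ∀ v ∈ Y, ¬ G.ColliderLinked (X ∪ Y ∪ Z) u v) → Indep I X Y Z from
    fun X Y Z => key _ X Y Z rfl
  intro n
  induction n using Nat.strong_induction_on with
  | _ n ih =>
  intro X Y Z hn hA hXY hXZ hYZ hsep
  rcases X.eq_empty_or_nonempty with rfl | hX
  · exact fun h => absurd h (by simp)
  obtain ⟨x, hx, hch, hloc⟩ := H _ hA (hX.mono (by intro; simp; tauto))
  -- Deleting a childless vertex keeps the set ancestrally closed, and links in the smaller set are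
  -- links in the larger one; so the induction hypothesis applies to what remains.
  have hcl : ∀ X' Y' Z' : Set V, X' ∪ Y' ∪ Z' = (X ∪ Y ∪ Z) \ {x} →
      G.AncestrallyClosed (X' ∪ Y' ∪ Z') := by
    intro X' Y' Z' e
    rw [e, MixedGraph.ancestrallyClosed_iff]
    rintro u v huv ⟨hv, hvx⟩
    refine ⟨MixedGraph.ancestrallyClosed_iff.1 hA _ _ huv hv, ?_⟩
    rintro rfl
    exact hch _ hv huv
  have hcard : ((X ∪ Y ∪ Z) \ {x}).ncard < n := hn ▸ Set.ncard_sdiff_singleton_lt_of_mem hx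
  have step : ∀ X' Y' Z' : Set V, X' ∪ Y' ∪ Z' = (X ∪ Y ∪ Z) \ {x} → X' ⊆ X → Y' ⊆ Y → Z' ⊆ Z →
      Indep I X' Y' Z' := by
    intro X' Y' Z' e hX' hY' hZ'
    refine ih _ hcard X' Y' Z' (by rw [e]) (hcl _ _ _ e) (hXY.mono hX' hY') (hXZ.mono hX' hZ')
      (hYZ.mono hY' hZ') fun u hu v hv hl => hsep u (hX' hu) v (hY' hv) (hl.mono ?_)
    rw [e]
    exact Set.sdiff_subset
  have disj : ∀ W : Set V, (∀ w ∈ W, w ∉ G.blanket (X ∪ Y ∪ Z) x) →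
      Disjoint W (G.blanket (X ∪ Y ∪ Z) x) := fun W h => Set.disjoint_left.2 fun {_} => h _
  have hXY' : ∀ v ∈ X, v ∉ Y := fun _ h => Set.disjoint_left.1 hXY h
  have hXZ' : ∀ v ∈ X, v ∉ Z := fun _ h => Set.disjoint_left.1 hXZ h
  have hYZ' : ∀ v ∈ Y, v ∉ Z := fun _ h => Set.disjoint_left.1 hYZ h
  have hdiff : ∀ S : Set V, x ∈ S → {x} ∪ S \ {x} = S := fun S hS =>
    Set.union_sdiff_cancel (by simpa)
  have dj : ∀ S : Set V, x ∉ S → Disjoint S {x} := fun S hS => by simpa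
  have subX : X ⊆ X ∪ Y ∪ Z := by intro; simp; tauto
  have subY : Y ⊆ X ∪ Y ∪ Z := by intro; simp; tauto
  have subZ : Z ⊆ X ∪ Y ∪ Z := by intro; simp; tauto
  rcases hx with (hxX | hxY) | hxZ
  · have h₁ := indep_singleton_of_disjoint_blanket hI hA (subX hxX) hloc subY (hXY' x hxX)
      (disj Y fun v hv hb => hsep x hxX v hv
        (MixedGraph.colliderLinked_of_mem_blanket (subX hxX) hb))
    have e : (X ∪ Y ∪ Z) \ (Y ∪ {x}) = X \ {x} ∪ Z := by
      ext v
      have := hXY' v; have := hXZ' v; have := hYZ' v; have := hXZ' x hxX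
      simp only [Set.mem_union, Set.mem_sdiff, Set.mem_singleton_iff]; grind
    rw [e] at h₁
    have h₂ := step (X \ {x}) Y Z (by
      have := hXY' x hxX; have := hXZ' x hxX
      ext v; simp only [Set.mem_union, Set.mem_sdiff, Set.mem_singleton_iff]; grind) Set.sdiff_subset le_rfl le_rfl
    -- Contraction of Y ⫫ {x} | (X \ {x}) ∪ Z with Y ⫫ X \ {x} | Z.
    have h₃ := (h₁.symm hI (dj _ (hXY' x hxX)).symm (by simpa using hXZ' x hxX)
      (Set.disjoint_union_right.2 ⟨hXY.symm.mono_right Set.sdiff_subset, hYZ⟩)).contraction hI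
      (dj _ (hXY' x hxX)) hYZ (hXY.symm.mono_right Set.sdiff_subset)
      (dj _ (hXZ' x hxX)).symm Set.disjoint_sdiff_right (hXZ.symm.mono_right Set.sdiff_subset)
      (h₂.symm hI (hXY.mono_left Set.sdiff_subset) (hXZ.mono_left Set.sdiff_subset) hYZ)
    rw [hdiff X hxX] at h₃
    exact h₃.symm hI hXY.symm hYZ hXZ
  · have hxX : x ∉ X := fun h => hXY' x h hxY
    have h₁ := indep_singleton_of_disjoint_blanket hI hA (subY hxY) hloc subX hxX
      (disj X fun v hv hb => hsep v hv x hxY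
        (MixedGraph.colliderLinked_of_mem_blanket (subY hxY) hb).symm)
    have e : (X ∪ Y ∪ Z) \ (X ∪ {x}) = Y \ {x} ∪ Z := by
      ext v
      have := hXY' v; have := hXZ' v; have := hYZ' v; have := hYZ' x hxY
      simp only [Set.mem_union, Set.mem_sdiff, Set.mem_singleton_iff]; grind
    rw [e] at h₁
    have h₂ := step X (Y \ {x}) Z (by
      have := hYZ' x hxY
      ext v; simp only [Set.mem_union, Set.mem_sdiff, Set.mem_singleton_iff]; grind) le_rfl Set.sdiff_subset le_rfl
    have h₃ := (h₁.symm hI (dj _ hxX).symm (by simpa using hYZ' x hxY)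
      (Set.disjoint_union_right.2 ⟨hXY.mono_right Set.sdiff_subset, hXZ⟩)).contraction hI
      (dj _ hxX) hXZ (hXY.mono_right Set.sdiff_subset)
      (dj _ (hYZ' x hxY)).symm Set.disjoint_sdiff_right (hYZ.symm.mono_right Set.sdiff_subset) h₂
    rwa [hdiff Y hxY] at h₃
  · have hxX : x ∉ X := fun h => hXZ' x h hxZ
    have hxY : x ∉ Y := fun h => hYZ' x h hxZ
    have h₂ := step X Y (Z \ {x}) (by
      ext v; simp only [Set.mem_union, Set.mem_sdiff, Set.mem_singleton_iff]; grind) le_rfl le_rfl Set.sdiff_subset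
    have hZX := hXZ.symm.mono_left (Set.sdiff_subset (s := Z) (t := {x}))
    have hZY := hYZ.symm.mono_left (Set.sdiff_subset (s := Z) (t := {x}))
    have hZx : Disjoint (Z \ {x}) {x} := Set.disjoint_sdiff_left
    rw [← hdiff Z hxZ]
    -- The blanket misses `Y` or, by separation, misses `X`. In either case x joins the missed set's
    -- opposite side by contraction over Z \ {x}, and weak union then puts it into the condition.
    by_cases hmb : ∀ v ∈ Y, v ∉ G.blanket (X ∪ Y ∪ Z) x
    · have h₁ := indep_singleton_of_disjoint_blanket hI hA (subZ hxZ) hloc subY hxY (disj Y hmb)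
      have e : (X ∪ Y ∪ Z) \ (Y ∪ {x}) = X ∪ Z \ {x} := by
        ext v
        have := hXY' v; have := hXZ' v; have := hYZ' v
        simp only [Set.mem_union, Set.mem_sdiff, Set.mem_singleton_iff]; grind
      rw [e] at h₁
      have h₃ := (h₁.symm hI (dj _ hxY).symm
        (Set.disjoint_union_right.2 ⟨(dj _ hxX).symm, hZx.symm⟩)
        (Set.disjoint_union_right.2 ⟨hXY.symm, hZY.symm⟩)).contraction hI
        (dj _ hxY) hZY.symm hXY.symm hZx.symm (dj _ hxX).symm hZX
        (h₂.symm hI hXY hZX.symm hZY.symm)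
      rw [Set.union_comm] at h₃
      exact (h₃.weakUnion hI hXY.symm hZY.symm (dj _ hxY) hZX.symm (dj _ hxX) hZx).symm hI
        hXY.symm (by rwa [hdiff Z hxZ]) (by rwa [hdiff Z hxZ])
    · push Not at hmb
      obtain ⟨w, hwY, hwb⟩ := hmb
      have h₁ := indep_singleton_of_disjoint_blanket hI hA (subZ hxZ) hloc subX hxX
        (disj X fun v hv hb => hsep v hv w hwY
          (MixedGraph.colliderLinked_of_mem_blanket_of_mem_blanket (subZ hxZ) hb hwb))
      have e : (X ∪ Y ∪ Z) \ (X ∪ {x}) = Y ∪ Z \ {x} := by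
        ext v
        have := hXY' v; have := hXZ' v; have := hYZ' v
        simp only [Set.mem_union, Set.mem_sdiff, Set.mem_singleton_iff]; grind
      rw [e] at h₁
      have h₃ := (h₁.symm hI (dj _ hxX).symm
        (Set.disjoint_union_right.2 ⟨(dj _ hxY).symm, hZx.symm⟩)
        (Set.disjoint_union_right.2 ⟨hXY, hZX.symm⟩)).contraction hI
        (dj _ hxX) hZX.symm hXY hZx.symm (dj _ hxY).symm hZY h₂
      rw [Set.union_comm] at h₃
      exact h₃.weakUnion hI hXY hZX.symm (dj _ hxX) hZY.symm (dj _ hxY) hZx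

end MVR

/-! ### Chain components and the two block properties -/

namespace MVR

universe u

variable {V : Type u} {G : MixedGraph V} {I : IndependenceModel V}

/-- The local statement for `x` from the statement for its district. -/
theorem indep_blanket_of_indep_biDistrict (hI : IsSemiGraphoid I) {A : Set V} {x : V}
    (h : Indep I (G.biDistrict A x) (A \ (G.biDistrict A x ∪ G.pa (G.biDistrict A x)))
      (G.pa (G.biDistrict A x))) :
    Indep I {x} (A \ (G.blanket A x ∪ {x})) (G.blanket A x) := by
  have hx := G.mem_biDistrict_self (A := A) (x := x)
  set d := G.biDistrict A x with hd
  have hpd : ∀ v ∈ G.pa d, v ∉ d := fun v hv => hv.1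
  have hb : G.blanket A x = d \ {x} ∪ G.pa d := Set.union_comm _ _
  have e₁ : d = {x} ∪ d \ {x} := (Set.union_sdiff_cancel (by simpa)).symm
  have e₂ : A \ (G.blanket A x ∪ {x}) = A \ (d ∪ G.pa d) := by
    rw [hb]
    ext v
    simp only [Set.mem_union, Set.mem_sdiff, Set.mem_singleton_iff]
    grind
  have d₁ : Disjoint d (A \ (d ∪ G.pa d)) :=
    Set.disjoint_left.2 fun v hv hv' => hv'.2 (.inl hv)
  have d₂ : Disjoint d (G.pa d) := Set.disjoint_left.2 fun v hv hv' => hpd v hv' hv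
  have d₃ : Disjoint (A \ (d ∪ G.pa d)) (G.pa d) :=
    Set.disjoint_left.2 fun v hv hv' => hv.2 (.inr hv')
  have hxd : {x} ⊆ d := by simpa
  rw [e₂, hb]
  have h' := h.symm hI d₁ d₂ d₃
  -- Both sets mention `d`; they are abstracted so that splitting `d` as {x} ∪ d \ {x} rewrites only
  -- the district itself.
  generalize hN : A \ (d ∪ G.pa d) = N at *
  generalize G.pa d = P at *
  have hdx : d \ {x} ⊆ d := Set.sdiff_subset
  rw [e₁] at h'
  exact (h'.weakUnion hI (d₁.symm.mono_right hxd) d₃ (d₁.symm.mono_right hdx) (d₂.mono_left hxd)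
    Set.disjoint_sdiff_right (d₂.symm.mono_right hdx)).symm hI (d₁.symm.mono_right hxd)
    (Set.disjoint_union_right.2 ⟨d₁.symm.mono_right hdx, d₃⟩)
    (Set.disjoint_union_right.2 ⟨Set.disjoint_sdiff_right, d₂.mono_left hxd⟩)

namespace MixedGraph

/-- The chain component of a vertex. -/
abbrev chainComp (G : MixedGraph V) (v : V) : G.ChainComponent := G.bi.connectedComponentMk v

variable {lt : G.ChainComponent → G.ChainComponent → Prop} {T : G.ChainComponent} {u v x : V}
  {A S N : Set V}

theorem mem_supp_iff : v ∈ T.supp ↔ G.chainComp v = T := Iff.rfl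

theorem chainComp_eq_of_adj (h : G.bi.Adj u v) : G.chainComp u = G.chainComp v :=
  SimpleGraph.ConnectedComponent.sound h.reachable

theorem compDir_of_dir (h : G.dir u v) : G.compDir (G.chainComp u) (G.chainComp v) :=
  ⟨u, rfl, v, rfl, h⟩

theorem mem_pre_iff : v ∈ G.pre lt T ↔ lt T (G.chainComp v) := by
  simp [pre]

theorem mem_paD_iff : v ∈ G.paD T ↔ G.compDir (G.chainComp v) T := by
  simp [paD]

theorem mem_ndD_iff : v ∈ G.ndD T ↔ ¬ Relation.ReflTransGen G.compDir T (G.chainComp v) := by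
  simp [ndD]

theorem IsMVRChainGraph.chainComp_ne (hG : G.IsMVRChainGraph) (h : G.dir u v) :
    G.chainComp u ≠ G.chainComp v := fun he =>
  hG.not_reachable h (SimpleGraph.ConnectedComponent.exact he)

theorem IsConsistentCompOrder.lt_of_compDir (hG : G.IsMVRChainGraph)
    (hlt : G.IsConsistentCompOrder lt) {T T' : G.ChainComponent} (h : G.compDir T T') :
    lt T' T := by
  have := hlt.isStrictTotalOrder
  rcases trichotomous_of lt T T' with h' | rfl | h'
  · exact absurd h (hlt.consistent _ _ h')
  · obtain ⟨u, rfl, v, hv, huv⟩ := h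
    exact absurd hv.symm (hG.chainComp_ne huv)
  · exact h'

theorem IsConsistentCompOrder.eq_or_lt_of_reflTransGen (hG : G.IsMVRChainGraph)
    (hlt : G.IsConsistentCompOrder lt) {T T' : G.ChainComponent}
    (h : Relation.ReflTransGen G.compDir T T') : T' = T ∨ lt T' T := by
  have := hlt.isStrictTotalOrder
  induction h with
  | refl => exact .inl rfl
  | tail _ h ih =>
    rcases ih with rfl | ih
    · exact .inr (hlt.lt_of_compDir hG h)
    · exact .inr (_root_.trans (hlt.lt_of_compDir hG h) ih)

/-- A union `N` of chain components other than `T` such that `N` and `N ∪ T` are ancestrally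
closed. -/
structure IsPast (G : MixedGraph V) (T : G.ChainComponent) (N : Set V) : Prop where
  parent : ∀ u v, G.dir u v → v ∈ N ∨ v ∈ T.supp → u ∈ N
  disjoint : ∀ v ∈ N, v ∉ T.supp
  bi : ∀ u v, G.bi.Adj u v → v ∈ N → u ∈ N

theorem isPast_pre (hG : G.IsMVRChainGraph) (hlt : G.IsConsistentCompOrder lt)
    (T : G.ChainComponent) : G.IsPast T (G.pre lt T) where
  parent u v huv h := by
    have := hlt.isStrictTotalOrder
    have h' := hlt.lt_of_compDir hG (compDir_of_dir huv)
    rw [mem_pre_iff, mem_supp_iff] at h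
    rw [mem_pre_iff]
    rcases h with h | rfl
    · exact _root_.trans h h'
    · exact h'
  disjoint v hv hT := by
    have := hlt.isStrictTotalOrder
    rw [mem_pre_iff, mem_supp_iff.1 hT] at hv
    exact irrefl_of lt T hv
  bi u v huv h := by
    rw [mem_pre_iff] at *
    rwa [chainComp_eq_of_adj huv]

/-- The total order serves as a witness that D is acyclic: a component reached from T is T or
smaller, whereas a parent of T is larger. -/
theorem isPast_ndD (hG : G.IsMVRChainGraph) (hlt : G.IsConsistentCompOrder lt)
    (T : G.ChainComponent) : G.IsPast T (G.ndD T) where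
  parent u v huv h := by
    have := hlt.isStrictTotalOrder
    have h' := compDir_of_dir huv
    rw [mem_ndD_iff, mem_supp_iff] at h
    rw [mem_ndD_iff]
    rcases h with h | rfl
    · exact fun hr => h (hr.tail h')
    · intro hr
      rcases hlt.eq_or_lt_of_reflTransGen hG hr with e | hl
      · exact hG.chainComp_ne huv e
      · exact asymm_of lt hl (hlt.lt_of_compDir hG h')
  disjoint v hv hT := by
    rw [mem_ndD_iff, mem_supp_iff.1 hT] at hv
    exact hv .refl
  bi u v huv h := by
    rw [mem_ndD_iff] at *
    rwa [chainComp_eq_of_adj huv]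

theorem pre_subset_ndD (hG : G.IsMVRChainGraph) (hlt : G.IsConsistentCompOrder lt) :
    G.pre lt T ⊆ G.ndD T := fun v hv => by
  have := hlt.isStrictTotalOrder
  rw [mem_pre_iff] at hv
  rw [mem_ndD_iff]
  intro hr
  rcases hlt.eq_or_lt_of_reflTransGen hG hr with e | hl
  · rw [e] at hv
    exact irrefl_of lt T hv
  · exact asymm_of lt hl hv

theorem paD_subset_pre (hG : G.IsMVRChainGraph) (hlt : G.IsConsistentCompOrder lt) :
    G.paD T ⊆ G.pre lt T := fun _ hv =>
  mem_pre_iff.2 (hlt.lt_of_compDir hG (mem_paD_iff.1 hv))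

theorem pa_subset_paD (hA : A ⊆ T.supp) : G.pa A ⊆ G.paD T := by
  rintro u ⟨_, v, hv, huv⟩
  rw [mem_paD_iff, ← mem_supp_iff.1 (hA hv)]
  exact compDir_of_dir huv

theorem IsPast.not_dir (hN : G.IsPast T N) (hu : u ∈ T.supp) (hv : v ∈ N ∪ T.supp) : ¬ G.dir u v := fun h =>
  hN.disjoint u (hN.parent u v h hv) hu

theorem IsPast.pa_subset (hN : G.IsPast T N)
    (hA : A ⊆ T.supp) : G.pa A ⊆ N := by
  rintro u ⟨_, v, hv, huv⟩
  exact hN.parent u v huv (.inr (hA hv))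

end MixedGraph

open MixedGraph

/-- Independences between unions of districts of a block and the other vertices, given a set that
contains the parents. -/
theorem PartitionMarkov.indep_block (hP : PartitionMarkov G I)
    {T : G.ChainComponent} {N X Y Z : Set V} (hN : G.IsPast T N) (hX : X ⊆ T.supp)
    (hY : Y ⊆ N ∪ T.supp) (hZ : Z ⊆ N) (hNYZ : N ⊆ Y ∪ Z) (hXY : Disjoint X Y)
    (hYZ : Disjoint Y Z) (hpa : G.pa X ⊆ Z) (hbi : ∀ u ∈ X, ∀ v ∈ Y, ¬ G.bi.Adj u v) :
    Indep I X Y Z := by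
  have hXZ : Disjoint X Z := Set.disjoint_left.2 fun v hv hv' => hN.disjoint v (hZ hv') (hX hv)
  have hB : X ∪ Y ∪ Z ⊆ N ∪ T.supp := by
    rintro v ((hv | hv) | hv)
    · exact .inr (hX hv)
    · exact hY hv
    · exact .inl (hZ hv)
  -- Parents of vertices of N ∪ T lie in N ⊆ Y ∪ Z, which gives closure. A link from X must start
  -- inside a district, since X has no children here; that district cannot leave X by a bidirected
  -- edge, and parents of X outside X lie in Z.
  refine hP X Y Z (ancestrallyClosed_iff.2 fun u v huv hv => ?_) hXY hXZ hYZ ?_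
  · rcases hNYZ (hN.parent u v huv (hB hv)) with h | h
    · exact .inl (.inr h)
    · exact .inr h
  · rintro u hu v hv ⟨a, ha, b, hb, rfl | hua, h⟩
    · have hbX : b ∈ X := by
        clear h
        induction hb with
        | refl => exact hu
        | tail _ h ih =>
          rcases h.2.1 with (h' | h') | h'
          · exact h'
          · exact absurd h.2.2 (hbi _ ih _ h')
          · exact absurd (hX ih) (hN.disjoint _ (hN.bi _ _ h.2.2 (hZ h')))
      rcases h with rfl | h
      · exact Set.disjoint_left.1 hXY hbX hv
      · exact Set.disjoint_left.1 hYZ hv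
          (hpa ⟨fun hvX => Set.disjoint_left.1 hXY hvX hv, b, hbX, h⟩)
    · exact hN.not_dir (hX hu) (hB ha) hua

theorem PartitionMarkov.indep_pa (hP : PartitionMarkov G I)
    {T : G.ChainComponent} {N A : Set V} (hN : G.IsPast T N) (hA : A ⊆ T.supp)
    (hpN : G.pa A ⊆ N) : Indep I A (N \ G.pa A) (G.pa A) := by
  refine hP.indep_block hN hA (Set.sdiff_subset.trans Set.subset_union_left) hpN
    (by simp) ?_ Set.disjoint_sdiff_left le_rfl ?_
  · exact Set.disjoint_left.2 fun v hv hv' => hN.disjoint v hv'.1 (hA hv)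
  · exact fun u hu v hv h => hN.disjoint u (hN.bi u v h hv.1) (hA hu)

variable {lt : G.ChainComponent → G.ChainComponent → Prop}

theorem PartitionMarkov.blockRecursive (hP : PartitionMarkov G I) (hG : G.IsMVRChainGraph)
    (hlt : G.IsConsistentCompOrder lt) (hI : IsSemiGraphoid I) : BlockRecursiveMarkov G I where
  iv0 T := by
    have hN := isPast_ndD hG hlt T
    have hp : G.paD T ⊆ G.ndD T := (paD_subset_pre hG hlt).trans (pre_subset_ndD hG hlt)
    refine hP.indep_block hN le_rfl (Set.sdiff_subset.trans Set.subset_union_left) hp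
      (by simp) ?_ Set.disjoint_sdiff_left (pa_subset_paD le_rfl) ?_
    · exact Set.disjoint_left.2 fun v hv hv' => hN.disjoint v hv'.1 hv
    · exact fun u hu v hv h => hN.disjoint u (hN.bi u v h hv.1) hu
  iv1 T A hA := by
    have hN := isPast_pre hG hlt T
    refine (hP.indep_pa hN hA (hN.pa_subset hA)).mono_right hI ?_ ?_
      Set.disjoint_sdiff_left (Set.sdiff_subset_sdiff_left (paD_subset_pre hG hlt))
    · exact Set.disjoint_left.2 fun v hv hv' => hN.disjoint v hv'.1 (hA hv)
    · exact Set.disjoint_left.2 fun v hv hv' => hv'.1 hv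
  iv2 T A hA _ := by
    have hN := isPast_ndD hG hlt T
    have hp : G.paD T ⊆ G.ndD T := (paD_subset_pre hG hlt).trans (pre_subset_ndD hG hlt)
    -- The rest of nd(T) is added to the right-hand side to make the three sets ancestrally closed,
    -- and is dropped again by decomposition.
    have hd₁ : Disjoint A (T.supp \ G.nb A ∪ G.ndD T \ G.paD T) := by
      refine Set.disjoint_left.2 fun v hv hv' => ?_
      rcases hv' with hv' | hv'
      · exact hv'.2 (.inl hv)
      · exact hN.disjoint v hv'.1 (hA hv)
    have hd₂ : Disjoint (T.supp \ G.nb A ∪ G.ndD T \ G.paD T) (G.paD T) := by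
      refine Set.disjoint_left.2 fun v hv hv' => ?_
      rcases hv with hv | hv
      · exact hN.disjoint v (hp hv') hv.1
      · exact hv.2 hv'
    refine Indep.mono_right hI hd₁
      (Set.disjoint_left.2 fun v hv hv' => hN.disjoint v (hp hv') (hA hv)) hd₂
      Set.subset_union_left (hP.indep_block hN hA ?_ hp ?_ hd₁ hd₂ (pa_subset_paD hA) ?_)
    · rintro v (hv | hv)
      · exact .inr hv.1
      · exact .inl hv.1
    · intro v hv
      by_cases h : v ∈ G.paD T
      · exact .inr h
      · exact .inl (.inr ⟨hv, h⟩)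
    · rintro u hu v (hv | hv) h
      · exact hv.2 (.inr ⟨u, hu, h.symm⟩)
      · exact hN.disjoint u (hN.bi u v h hv.1) (hA hu)

theorem PartitionMarkov.mrMarkov (hP : PartitionMarkov G I) (hG : G.IsMVRChainGraph)
    (hlt : G.IsConsistentCompOrder lt) : MRMarkov G lt I where
  mr1 T A hA _ :=
    hP.indep_pa (isPast_pre hG hlt T) hA ((isPast_pre hG hlt T).pa_subset hA)
  mr2 T A hA _ := by
    intro c
    have hN := isPast_pre hG hlt T
    have hcA : ∀ c, G.compSet A c ⊆ T.supp := by
      rintro c _ ⟨v, _, rfl⟩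
      exact hA v.2
    refine hP.indep_block hN (hcA c) ?_ le_rfl Set.subset_union_right ?_ ?_
      (hN.pa_subset (hcA c)) ?_
    · exact Set.iUnion₂_subset fun j _ => (hcA j).trans Set.subset_union_right
    · simp only [Set.disjoint_iUnion_right]
      intro j hj
      refine Set.disjoint_left.2 ?_
      rintro _ ⟨v, hv, rfl⟩ ⟨w, hw, hvw⟩
      obtain rfl := Subtype.ext hvw
      exact hj (hw.symm.trans hv)
    · simp only [Set.disjoint_iUnion_left]
      exact fun j hj => Set.disjoint_left.2 fun v hv hv' => hN.disjoint v hv' (hcA j hv)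
    · intro u hu v hv h
      simp only [Set.mem_iUnion] at hv
      obtain ⟨j, hj, w, hw, rfl⟩ := hv
      obtain ⟨z, hz, rfl⟩ := hu
      refine hj (hw.symm.trans (Eq.trans ?_ hz))
      exact SimpleGraph.ConnectedComponent.sound
        (SimpleGraph.Adj.reachable (show (G.bi.induce A).Adj w z from h.symm))

/-- To prove the partition Markov property it suffices to consider, for a union `S` of vertices
of a block, the districts of `S`. -/
theorem partitionMarkov_of_block [Finite V] (hI : IsSemiGraphoid I) (hG : G.IsMVRChainGraph)
    (hlt : G.IsConsistentCompOrder lt)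
    (H : ∀ T : G.ChainComponent, ∀ S ⊆ T.supp, ∀ x ∈ S, Indep I (G.biDistrict S x)
      (S \ G.biDistrict S x ∪ G.pre lt T \ G.pa (G.biDistrict S x)) (G.pa (G.biDistrict S x))) :
    PartitionMarkov G I := by
  refine partitionMarkov_of_local hI fun A hA hne => ?_
  have := hlt.isStrictTotalOrder
  have : Finite G.ChainComponent := Quot.finite _
  have hwf : WellFounded lt := Finite.wellFounded_of_trans_of_irrefl lt
  -- Parents are larger in the order, so the least component that meets A has no children in A, and
  -- the rest of A lies in its past.
  obtain ⟨T, ⟨x, hxT, hxA⟩, hT⟩ := hwf.has_min {T | (T.supp ∩ A).Nonempty} <| by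
    obtain ⟨v, hv⟩ := hne
    exact ⟨G.chainComp v, v, rfl, hv⟩
  have hle : ∀ v ∈ A, v ∉ T.supp → v ∈ G.pre lt T := by
    intro v hv hvT
    rw [mem_pre_iff]
    rcases trichotomous_of lt T (G.chainComp v) with h | h | h
    · exact h
    · exact absurd h.symm hvT
    · exact absurd h (hT _ ⟨v, rfl, hv⟩)
  have hN := isPast_pre hG hlt T
  have hsub : A ⊆ G.pre lt T ∪ T.supp := fun v hv => by
    by_cases h : v ∈ T.supp
    · exact .inr h
    · exact .inl (hle v hv h)
  refine ⟨x, hxA, fun y hy => hN.not_dir hxT (hsub hy), ?_⟩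
  -- Bidirected edges never leave a chain component.
  have hd : G.biDistrict (A ∩ T.supp) x = G.biDistrict A x := by
    refine Set.Subset.antisymm (biDistrict_mono Set.inter_subset_left) fun y hy => ?_
    induction hy with
    | refl => exact mem_biDistrict_self
    | @tail b c _ h ih =>
      have hb := biDistrict_subset (A := A ∩ T.supp) ⟨hxA, hxT⟩ ih
      refine mem_biDistrict_trans ih (.single ⟨hb, ⟨h.2.1, ?_⟩, h.2.2⟩)
      rw [mem_supp_iff, ← chainComp_eq_of_adj h.2.2]
      exact hb.2
  have h := H T (A ∩ T.supp) Set.inter_subset_right x ⟨hxA, hxT⟩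
  rw [hd] at h
  have hdT : G.biDistrict A x ⊆ T.supp :=
    hd ▸ (biDistrict_subset (A := A ∩ T.supp) ⟨hxA, hxT⟩).trans Set.inter_subset_right
  have hpa := hN.pa_subset hdT
  refine indep_blanket_of_indep_biDistrict hI (h.mono_right hI ?_ ?_ ?_ ?_)
  · refine Set.disjoint_left.2 fun v hv hv' => ?_
    rcases hv' with hv' | hv'
    · exact hv'.2 hv
    · exact hN.disjoint v hv'.1 (hdT hv)
  · exact Set.disjoint_left.2 fun v hv hv' => hv'.1 hv
  · refine Set.disjoint_left.2 fun v hv hv' => ?_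
    rcases hv with hv | hv
    · exact hN.disjoint v (hpa hv') hv.1.2
    · exact hv.2 hv'
  · rintro v ⟨hv, hv'⟩
    rw [Set.mem_union, not_or] at hv'
    by_cases h : v ∈ T.supp
    · exact .inl ⟨⟨hv, h⟩, hv'.1⟩
    · exact .inr ⟨hle v hv h, hv'.2⟩

/-- For a district d of S, (MR2) for S gives d ⫫ S \ d | pre(T) and (MR1) gives d ⫫ pre(T) \ pa(d) |
pa(d); contraction combines them. If S is connected, S \ d is empty. -/
theorem MRMarkov.partitionMarkov [Finite V] (hM : MRMarkov G lt I) (hI : IsSemiGraphoid I)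
    (hG : G.IsMVRChainGraph) (hlt : G.IsConsistentCompOrder lt) : PartitionMarkov G I := by
  refine partitionMarkov_of_block hI hG hlt fun T S hS x hx => ?_
  have hN := isPast_pre hG hlt T
  have hdS := biDistrict_subset (G := G) hx
  have hdT := hdS.trans hS
  have hpa := hN.pa_subset hdT
  have h₁ := hM.mr1 T _ hdT connectedSet_biDistrict
  have h₂ : Indep I (G.biDistrict S x) (S \ G.biDistrict S x) (G.pre lt T) := by
    by_cases hc : G.ConnectedSet S
    · have : S \ G.biDistrict S x = ∅ := Set.sdiff_eq_empty.2 fun y hy =>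
        mem_biDistrict_iff_reachable.2 (hc.preconnected ⟨x, hx⟩ ⟨y, hy⟩)
      rw [this]
      exact fun _ h => absurd h (by simp)
    · have h := hM.mr2 T S hS hc ((G.bi.induce S).connectedComponentMk ⟨x, hx⟩)
      have key : ∀ y : S, (y : V) ∈ G.biDistrict S x ↔
          (G.bi.induce S).connectedComponentMk y =
            (G.bi.induce S).connectedComponentMk ⟨x, hx⟩ := fun y => by
        rw [SimpleGraph.ConnectedComponent.eq, SimpleGraph.reachable_comm]
        exact mem_biDistrict_iff_reachable (x := ⟨x, hx⟩)
      convert h using 1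
      · ext y
        constructor
        · exact fun hy => ⟨⟨y, hdS hy⟩, (key ⟨y, hdS hy⟩).1 hy, rfl⟩
        · rintro ⟨y, hy, rfl⟩
          exact (key y).2 hy
      · ext y
        simp only [Set.mem_iUnion]
        constructor
        · rintro ⟨hy, hy'⟩
          exact ⟨(G.bi.induce S).connectedComponentMk ⟨y, hy⟩,
            fun he => hy' ((key ⟨y, hy⟩).2 he), ⟨y, hy⟩, rfl, rfl⟩
        · rintro ⟨j, hj, y, rfl, rfl⟩
          exact ⟨y.2, fun hy => hj ((key y).1 hy)⟩
  generalize hd : G.biDistrict S x = d at *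
  refine Indep.contraction hI Set.disjoint_sdiff_right
    (Set.disjoint_left.2 fun v hv hv' => hv'.1 hv)
    (Set.disjoint_left.2 fun v hv hv' => hN.disjoint v hv'.1 (hdT hv))
    (Set.disjoint_left.2 fun v hv hv' => hN.disjoint v (hpa hv') (hS hv.1))
    (Set.disjoint_left.2 fun v hv hv' => hN.disjoint v hv'.1 (hS hv.1))
    Set.disjoint_sdiff_right ?_ h₁
  rwa [Set.sdiff_union_of_subset hpa]

/-- For a district d of S, (IV2) gives d ⫫ S \ d | pa(T), because S \ d contains no neighbour of d.
Weak union in (IV0) gives the independence of d from nd(T) \ pa(T) given (S \ d) ∪ pa(T).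
Contracting these two, and then with (IV1), reduces the condition to pa(d). -/
theorem BlockRecursiveMarkov.partitionMarkov [Finite V] (hM : BlockRecursiveMarkov G I)
    (hI : IsSemiGraphoid I) (hG : G.IsMVRChainGraph) (hlt : G.IsConsistentCompOrder lt) :
    PartitionMarkov G I := by
  refine partitionMarkov_of_block hI hG hlt fun T S hS x hx => ?_
  have hN := isPast_ndD hG hlt T
  have hsub : G.pre lt T ⊆ G.ndD T := pre_subset_ndD hG hlt
  have hpD : G.paD T ⊆ G.ndD T := (paD_subset_pre hG hlt).trans hsub
  have hdS := biDistrict_subset (G := G) hx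
  have hdT := hdS.trans hS
  have hpa : G.pa (G.biDistrict S x) ⊆ G.paD T := pa_subset_paD hdT
  have hnb : S \ G.biDistrict S x ⊆ T.supp \ G.nb (G.biDistrict S x) := by
    rintro v ⟨hv, hvd⟩
    refine ⟨hS hv, ?_⟩
    rintro (h | ⟨w, hw, h⟩)
    · exact hvd h
    · exact hvd (mem_biDistrict_trans hw (.single ⟨hdS hw, hv, h.symm⟩))
  have h₀ := hM.iv0 T
  have h₁ := hM.iv1 T _ hdT
  have h₂ := hM.iv2 T _ hdT connectedSet_biDistrict
  generalize hd : G.biDistrict S x = d at *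
  have dTD : Disjoint T.supp (G.paD T) :=
    Set.disjoint_left.2 fun v hv hv' => hN.disjoint v (hpD hv') hv
  have dTN : Disjoint T.supp (G.ndD T \ G.paD T) :=
    Set.disjoint_left.2 fun v hv hv' => hN.disjoint v hv'.1 hv
  have dND : Disjoint (G.ndD T \ G.paD T) (G.paD T) := Set.disjoint_sdiff_left
  have hrT : S \ d ⊆ T.supp := Set.sdiff_subset.trans hS
  have ddr : Disjoint d (S \ d) := Set.disjoint_sdiff_right
  have h₂' : Indep I d (S \ d) (G.paD T) :=
    h₂.mono_right hI (Set.disjoint_left.2 fun v hv hv' => hv'.2 (.inl hv)) (dTD.mono_left hdT)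
      (dTD.mono_left Set.sdiff_subset) hnb
  have h₀' : Indep I d (G.ndD T \ G.paD T) (S \ d ∪ G.paD T) := by
    have h := (h₀.mono_left hI dTN dTD dND (D := d ∪ S \ d) (Set.union_subset hdT hrT)).symm hI
      (dTN.mono_left (Set.union_subset hdT hrT)) (dTD.mono_left (Set.union_subset hdT hrT)) dND
    exact (h.weakUnion hI (dTN.symm.mono_right hdT) dND (dTN.symm.mono_right hrT)
      (dTD.mono_left hdT) ddr (dTD.symm.mono_right hrT)).symm hI (dTN.symm.mono_right hdT)
      (Set.disjoint_union_right.2 ⟨dTN.symm.mono_right hrT, dND⟩)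
      (Set.disjoint_union_right.2 ⟨ddr, dTD.mono_left hdT⟩)
  have h₃ : Indep I d (G.ndD T \ G.paD T ∪ S \ d) (G.paD T) :=
    h₀'.contraction hI (dTN.mono_left hdT) (dTD.mono_left hdT) ddr dND
      (dTN.symm.mono_right hrT) (dTD.symm.mono_right hrT) h₂'
  have dpD : Disjoint d (G.paD T \ G.pa d) := (dTD.mono_left hdT).mono_right Set.sdiff_subset
  have dNr : Disjoint (G.ndD T \ G.paD T ∪ S \ d) (G.paD T) :=
    Set.disjoint_union_left.2 ⟨dND, dTD.mono_left hrT⟩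
  have ddN : Disjoint d (G.ndD T \ G.paD T ∪ S \ d) :=
    Set.disjoint_union_right.2 ⟨dTN.mono_left hdT, ddr⟩
  have dpa : Disjoint d (G.pa d) := (dTD.mono_left hdT).mono_right hpa
  have h₄ := Indep.contraction hI ddN dpa dpD (dNr.mono_right hpa)
    (dNr.mono_right Set.sdiff_subset) Set.disjoint_sdiff_right
    (by rwa [Set.sdiff_union_of_subset hpa]) h₁
  refine h₄.mono_right hI (Set.disjoint_union_right.2 ⟨ddN, dpD⟩) dpa
    (Set.disjoint_union_left.2 ⟨dNr.mono_right hpa, Set.disjoint_sdiff_left⟩) ?_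
  rintro v (hv | ⟨hv, hv'⟩)
  · exact .inl (.inr hv)
  · by_cases h : v ∈ G.paD T
    · exact .inr ⟨h, hv'⟩
    · exact .inl (.inl ⟨hsub hv, h⟩)

end MVR

/-! ### Open walks and m-separation -/

namespace MVR

universe u

namespace MixedGraph

variable {V : Type u} {G : MixedGraph V} {A X Y Z : Set V} {a b u v w x y : V}

/-! ### Open walks as sequences of vertices -/

/-- `f (i + 1)` is a collider of the sequence `f`. -/
def SeqCollider (G : MixedGraph V) (f : ℕ → V) (i : ℕ) : Prop :=
  G.ArrowheadAt (f i) (f (i + 1)) ∧ G.ArrowheadAt (f (i + 2)) (f (i + 1))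

/-- The sequence `f 0, …, f n` is a walk with all inner colliders in `an(Z)` and no inner
noncollider in `Z`; vertices may be repeated. -/
def IsOpenSeq (G : MixedGraph V) (Z : Set V) (n : ℕ) (f : ℕ → V) : Prop :=
  (∀ i < n, G.skeleton.Adj (f i) (f (i + 1))) ∧
    ∀ i, i + 2 ≤ n → (G.SeqCollider f i → f (i + 1) ∈ G.an Z) ∧
      (¬ G.SeqCollider f i → f (i + 1) ∉ Z)

theorem IsMVRChainGraph.not_arrowheadAt (hG : G.IsMVRChainGraph) (h : G.dir u v) :
    ¬ G.ArrowheadAt v u := by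
  rintro (h' | h')
  · exact hG u v h (.single (.inl h'))
  · exact hG u v h (.single (.inr h'))

theorem dir_of_adj_of_not_arrowheadAt (h : G.skeleton.Adj u v) (h' : ¬ G.ArrowheadAt v u) :
    G.dir u v := by
  rcases h.2 with h | h | h
  · exact h
  · exact absurd (.inl h) h'
  · exact absurd (.inr h.symm) h'

theorem skeleton_adj_of_dir (hG : G.IsMVRChainGraph) (h : G.dir u v) : G.skeleton.Adj u v :=
  ⟨fun e => hG u v h (e ▸ .refl), .inl h⟩

theorem skeleton_adj_of_bi (h : G.bi.Adj u v) : G.skeleton.Adj u v := ⟨h.ne, .inr (.inr h)⟩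

variable {n : ℕ} {f : ℕ → V}

/-- An open sequence that leaves a vertex along a directed edge either is directed until `j`, or
meets a collider, so that the vertex is in `an(Z)`. -/
theorem IsOpenSeq.transGen_or_mem_an (hf : G.IsOpenSeq Z n f) {i : ℕ} (hi : G.dir (f i) (f (i + 1)))
    (m : ℕ) (hm : i + 1 + m ≤ n) :
    (Relation.TransGen G.dir (f i) (f (i + 1 + m)) ∧ G.dir (f (i + m)) (f (i + 1 + m))) ∨
      f i ∈ G.an Z := by
  induction m with
  | zero => exact .inl ⟨.single hi, hi⟩
  | succ m ih =>
    rcases ih (by omega) with ⟨h₁, h₂⟩ | h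
    · have e : i + m + 1 = i + 1 + m := by omega
      have e₂ : i + m + 2 = i + 1 + (m + 1) := by omega
      have e₃ : i + (m + 1) = i + 1 + m := by omega
      have hp := hf.2 (i + m) (by omega)
      have ha := hf.1 (i + 1 + m) (by omega)
      unfold SeqCollider at hp
      rw [e, e₂] at hp
      rw [e₃]
      rw [show i + 1 + m + 1 = i + 1 + (m + 1) by omega] at ha
      by_cases hc : G.ArrowheadAt (f (i + 1 + (m + 1))) (f (i + 1 + m))
      · obtain ⟨z, hz, hz'⟩ := hp.1 ⟨.inl h₂, hc⟩
        exact .inr ⟨z, hz, h₁.to_reflTransGen.trans hz'⟩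
      · have hd := dir_of_adj_of_not_arrowheadAt ha hc
        exact .inl ⟨h₁.tail hd, hd⟩
    · exact .inr h

/-- Mirror image of the preceding argument, followed towards the start of the sequence. -/
theorem IsOpenSeq.reflTransGen_or_mem_an (hf : G.IsOpenSeq Z n f) {i : ℕ} (hi : i + 1 ≤ n)
    (h : G.dir (f (i + 1)) (f i)) :
    Relation.ReflTransGen G.dir (f (i + 1)) (f 0) ∨ f (i + 1) ∈ G.an Z := by
  induction i with
  | zero => exact .inl (.single h)
  | succ i ih =>
    by_cases hc : G.ArrowheadAt (f i) (f (i + 1))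
    · obtain ⟨z, hz, hz'⟩ := (hf.2 i (by omega)).1 ⟨hc, .inl h⟩
      exact .inr ⟨z, hz, hz'.head h⟩
    · have hd := dir_of_adj_of_not_arrowheadAt (hf.1 i (by omega)).symm hc
      rcases ih (by omega) hd with h' | ⟨z, hz, hz'⟩
      · exact .inl (h'.head h)
      · exact .inr ⟨z, hz, hz'.head h⟩

/-- An inner noncollider has an outgoing edge; following it leads to an endpoint or to a collider,
which is in an(Z). -/
theorem IsOpenSeq.mem_an (hf : G.IsOpenSeq Z n f) (h₀ : f 0 ∈ X) (hn : f n ∈ Y) {i : ℕ}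
    (hi : i ≤ n) : f i ∈ G.an (X ∪ Y ∪ Z) := by
  rcases i with _ | i
  · exact subset_an (.inl (.inl h₀))
  rcases hi.eq_or_lt with rfl | hi
  · exact subset_an (.inl (.inr hn))
  by_cases hc : G.SeqCollider f i
  · obtain ⟨z, hz, hz'⟩ := (hf.2 i hi).1 hc
    exact ⟨z, .inr hz, hz'⟩
  · rw [SeqCollider, not_and_or] at hc
    rcases hc with hc | hc
    · have hd := dir_of_adj_of_not_arrowheadAt (hf.1 i (by omega)).symm hc
      rcases hf.reflTransGen_or_mem_an (by omega) hd with h | ⟨z, hz, hz'⟩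
      · exact ⟨_, .inl (.inl h₀), h⟩
      · exact ⟨z, .inr hz, hz'⟩
    · have hd := dir_of_adj_of_not_arrowheadAt (hf.1 (i + 1) hi) hc
      have := hf.transGen_or_mem_an hd (n - (i + 2)) (by omega)
      rw [show i + 1 + 1 + (n - (i + 2)) = n by omega] at this
      rcases this with ⟨h, _⟩ | ⟨z, hz, hz'⟩
      · exact ⟨_, .inl (.inr hn), h.to_reflTransGen⟩
      · exact ⟨z, .inr hz, hz'⟩

theorem IsMVRChainGraph.not_transGen (hG : G.IsMVRChainGraph) :
    ¬ Relation.TransGen G.dir u u := fun h => by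
  obtain ⟨v, huv, hv⟩ := (Relation.TransGen.head'_iff).1 h
  exact hG u v huv (Relation.ReflTransGen.mono (fun _ _ => Or.inl) _ _ hv)

/-- Cutting out the part of an open sequence between two visits of a vertex. -/
theorem IsOpenSeq.shortcut (hG : G.IsMVRChainGraph) (hf : G.IsOpenSeq Z n f) {i m : ℕ}
    (hm : 0 < m) (him : i + m ≤ n) (he : f i = f (i + m)) :
    G.IsOpenSeq Z (n - m) (fun k => if k ≤ i then f k else f (k + m)) := by
  set g : ℕ → V := fun k => if k ≤ i then f k else f (k + m) with hg
  have g₁ : ∀ k ≤ i, g k = f k := fun k hk => if_pos hk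
  have g₂ : ∀ k, i ≤ k → g k = f (k + m) := fun k hk => by
    rcases hk.eq_or_lt with rfl | hk
    · rw [g₁ _ le_rfl, he]
    · exact if_neg (by omega)
  refine ⟨fun k hk => ?_, fun k hk => ?_⟩
  · rcases Nat.lt_or_ge k i with h | h
    · rw [g₁ k h.le, g₁ (k + 1) h]
      exact hf.1 k (by omega)
    · rw [g₂ k h, g₂ (k + 1) (by omega), show k + 1 + m = k + m + 1 by omega]
      exact hf.1 (k + m) (by omega)
  · have e₁ : k + 1 + m = k + m + 1 := by omega
    have e₂ : k + 2 + m = k + m + 2 := by omega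
    rcases lt_trichotomy (k + 1) i with h | h | h
    · unfold SeqCollider
      rw [g₁ k (by omega), g₁ (k + 1) (by omega), g₁ (k + 2) (by omega)]
      exact hf.2 k (by omega)
    · have p₁ := hf.2 k (by omega)
      have p₂ := hf.2 (k + m) (by omega)
      have hv : f (k + m + 1) = f (k + 1) := by rw [← e₁, h, he]
      unfold SeqCollider at *
      rw [g₁ k (by omega), g₁ (k + 1) (by omega), g₂ (k + 2) (by omega), e₂]
      rw [hv] at p₂
      -- At the junction the left edge comes from the first visit and the right edge from the
      -- second. If it becomes a collider without having been one at the first visit, the walk left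
      -- it along an outgoing edge; returning by directed edges alone would close a cycle, so it is
      -- in an(Z). If it is in Z, both visits were colliders, hence so is the junction.
      refine ⟨fun hc => ?_, fun hc hZ => ?_⟩
      · by_cases hc₁ : G.ArrowheadAt (f (k + 2)) (f (k + 1))
        · exact p₁.1 ⟨hc.1, hc₁⟩
        · have hd := dir_of_adj_of_not_arrowheadAt (hf.1 (k + 1) (by omega)) hc₁
          have := hf.transGen_or_mem_an hd (m - 1) (by omega)
          rw [show k + 1 + 1 + (m - 1) = k + m + 1 by omega, hv] at this
          exact this.resolve_left fun h => hG.not_transGen h.1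
      · have c₁ := not_not.1 fun hn => p₁.2 hn hZ
        have c₂ := not_not.1 fun hn => p₂.2 hn hZ
        exact hc ⟨c₁.1, c₂.2⟩
    · unfold SeqCollider
      rw [g₂ k (by omega), g₂ (k + 1) (by omega), g₂ (k + 2) (by omega), e₁, e₂]
      exact hf.2 (k + m) (by omega)

end MixedGraph

theorem _root_.SimpleGraph.exists_walk_getVert_eq {V : Type u} (H : SimpleGraph V) (n : ℕ)
    (f : ℕ → V) (h : ∀ i < n, H.Adj (f i) (f (i + 1))) :
    ∃ p : H.Walk (f 0) (f n), p.length = n ∧ ∀ i ≤ n, p.getVert i = f i := by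
  induction n generalizing f with
  | zero =>
    exact ⟨.nil, rfl, fun i hi => by obtain rfl : i = 0 := by omega
                                     rfl⟩
  | succ n ih =>
    obtain ⟨p, hp, hp'⟩ := ih (fun i => f (i + 1)) fun i hi => h (i + 1) (by omega)
    refine ⟨.cons (h 0 (by omega)) p, by simp [hp], fun i hi => ?_⟩
    rcases i with _ | i
    · rfl
    · exact hp' i (by omega)

namespace MixedGraph

variable {V : Type u} {G : MixedGraph V} {A X Y Z : Set V} {a b u v w x y : V} {n : ℕ} {f : ℕ → V}

/-- The endpoints of an open walk are joined by an m-connecting path. -/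
theorem IsOpenSeq.exists_isMConnecting (hG : G.IsMVRChainGraph) (hf : G.IsOpenSeq Z n f)
    (hfa : f 0 = a) (hfb : f n = b) (ha : a ∉ Z) (hb : b ∉ Z) :
    ∃ p : G.skeleton.Walk a b, G.IsMConnecting p Z := by
  induction n using Nat.strong_induction_on generalizing f with
  | _ n ih =>
  by_cases hinj : ∀ i m, 0 < m → i + m ≤ n → f i ≠ f (i + m)
  · subst hfa hfb
    obtain ⟨p, hp, hp'⟩ := G.skeleton.exists_walk_getVert_eq n f hf.1
    refine ⟨p, (SimpleGraph.Walk.IsPath.getVert_injOn_iff p).1 ?_, ha, hb, fun i hi => ?_⟩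
    · intro i hi j hj hij
      have hi : i ≤ n := hp ▸ hi
      have hj : j ≤ n := hp ▸ hj
      rw [hp' i hi, hp' j hj] at hij
      rcases lt_trichotomy i j with h | h | h
      · exact absurd (by rwa [Nat.add_sub_cancel' h.le]) (hinj i (j - i) (by omega) (by omega))
      · exact h
      · exact absurd (by rw [Nat.add_sub_cancel' h.le, hij]) (hinj j (i - j) (by omega) (by omega))
    · have := hf.2 i (by omega)
      unfold IsColliderAt
      rw [hp' i (by omega), hp' (i + 1) (by omega), hp' (i + 2) (by omega)]
      exact this
  · push Not at hinj
    obtain ⟨i, m, hm, him, he⟩ := hinj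
    refine ih (n - m) (by omega) (hf.shortcut hG hm him he) (by simpa using hfa) ?_
    rw [← hfb]
    split_ifs with h
    · rw [show n - m = i by omega, he, show i + m = n by omega]
    · rw [show n - m + m = n by omega]

/-- `v` is the endpoint of an open walk from `X` whose last edge has an arrowhead at `v` if and
only if `h` holds. -/
def OpenReach (G : MixedGraph V) (X Z : Set V) (v : V) (h : Prop) : Prop :=
  ∃ n f, G.IsOpenSeq Z n f ∧ f 0 ∈ X ∧ f n = v ∧
    (h ↔ ∃ m, n = m + 1 ∧ G.ArrowheadAt (f m) (f (m + 1)))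

theorem openReach_of_mem (hx : x ∈ X) : G.OpenReach X Z x False :=
  ⟨0, fun _ => x, ⟨by simp, by simp⟩, hx, rfl, by simp⟩

/-- The flag `h` is all that must be remembered of the walk: with the next edge it decides whether
`v` is a collider. -/
theorem OpenReach.step {h : Prop} (hv : G.OpenReach X Z v h) (hvw : G.skeleton.Adj v w)
    (h₁ : h → G.ArrowheadAt w v → v ∈ G.an Z) (h₂ : ¬ (h ∧ G.ArrowheadAt w v) → v ∉ Z) :
    G.OpenReach X Z w (G.ArrowheadAt v w) := by
  obtain ⟨n, f, hf, h₀, rfl, hh⟩ := hv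
  set g : ℕ → V := fun k => if k ≤ n then f k else w with hg
  have g₁ : ∀ k ≤ n, g k = f k := fun k hk => if_pos hk
  have g₂ : g (n + 1) = w := if_neg (by omega)
  refine ⟨n + 1, g, ⟨fun i hi => ?_, fun i hi => ?_⟩, by rwa [g₁ 0 (by omega)], g₂, ?_⟩
  · rcases Nat.lt_or_ge i n with h | h
    · rw [g₁ i h.le, g₁ (i + 1) h]
      exact hf.1 i h
    · obtain rfl : i = n := by omega
      rwa [g₁ i le_rfl, g₂]
  · unfold SeqCollider
    rcases Nat.lt_or_ge (i + 1) n with hin | hin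
    · rw [g₁ i (by omega), g₁ (i + 1) (by omega), g₁ (i + 2) (by omega)]
      exact hf.2 i (by omega)
    · obtain rfl : n = i + 1 := by omega
      rw [g₁ i (by omega), g₁ (i + 1) (by omega), g₂]
      have hh' : h ↔ G.ArrowheadAt (f i) (f (i + 1)) := by
        rw [hh]
        exact ⟨fun ⟨m, hm, ha⟩ => by obtain rfl : i = m := by omega
                                     exact ha, fun ha => ⟨i, rfl, ha⟩⟩
      rw [← hh']
      exact ⟨fun hc => h₁ hc.1 hc.2, h₂⟩
  · constructor
    · exact fun ha => ⟨n, rfl, by rwa [g₁ n le_rfl, g₂]⟩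
    · rintro ⟨m, hm, ha⟩
      obtain rfl : n = m := by omega
      rwa [g₁ n le_rfl, g₂] at ha

/-- An open walk to `v` that can be continued by an edge with an arrowhead at `v`. -/
def Passable (G : MixedGraph V) (X Z : Set V) (v : V) : Prop :=
  ∃ h, G.OpenReach X Z v h ∧ (h → v ∈ G.an Z) ∧ (¬ h → v ∉ Z)

/-- Traverse the directed path backwards from `x`. Its inner vertices are noncolliders outside Z,
and it arrives at the tail of an edge. -/
theorem openReach_of_reflTransGen (hG : G.IsMVRChainGraph)
    (h : Relation.ReflTransGen G.dir a x) (hx : x ∈ X) (ha : a ∉ G.an Z) :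
    G.OpenReach X Z a False := by
  induction h using Relation.ReflTransGen.head_induction_on with
  | refl => exact openReach_of_mem hx
  | @head c d hcd _ ih =>
    have hd : d ∉ G.an Z := fun ⟨z, hz, hz'⟩ => ha ⟨z, hz, hz'.head hcd⟩
    have := (ih hd).step (skeleton_adj_of_dir hG hcd).symm False.elim
      fun _ hZ => hd (subset_an hZ)
    rwa [eq_false (hG.not_arrowheadAt hcd)] at this

theorem OpenReach.exists_of_reflTransGen (hG : G.IsMVRChainGraph) {h : Prop}
    (hr : G.OpenReach X Z a h) (hy : Relation.ReflTransGen G.dir a y) (ha : a ∉ G.an Z) :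
    ∃ h', G.OpenReach X Z y h' := by
  induction hy using Relation.ReflTransGen.head_induction_on generalizing h with
  | refl => exact ⟨h, hr⟩
  | @head c d hcd _ ih =>
    refine ih (hr.step (skeleton_adj_of_dir hG hcd)
      (fun _ ha => absurd ha (hG.not_arrowheadAt hcd)) fun _ hZ => ha (subset_an hZ)) ?_
    exact fun ⟨z, hz, hz'⟩ => ha ⟨z, hz, hz'.head hcd⟩

/-- A vertex of an(Z) may be a collider. Otherwise it is an ancestor of X, and the walk is replaced
by a reversed directed path from X that arrives without arrowhead; or it is an ancestor of Y, and
the walk continues down to Y. -/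
theorem OpenReach.passable_or (hG : G.IsMVRChainGraph) {h : Prop}
    (hr : G.OpenReach X Z a h) (ha : a ∈ G.an (X ∪ Y ∪ Z)) (hZ : ¬ h → a ∉ Z) :
    G.Passable X Z a ∨ ∃ y ∈ Y, ∃ h', G.OpenReach X Z y h' := by
  by_cases haZ : a ∈ G.an Z
  · exact .inl ⟨h, hr, fun _ => haZ, hZ⟩
  obtain ⟨b, (hb | hb) | hb, hab⟩ := ha
  · exact .inl ⟨False, openReach_of_reflTransGen hG hab hb haZ, False.elim,
      fun _ h => haZ (subset_an h)⟩
  · exact .inr ⟨b, hb, hr.exists_of_reflTransGen hG hab haZ⟩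
  · exact absurd ⟨b, hb, hab⟩ haZ

theorem Passable.step (hv : G.Passable X Z v) (hvw : G.skeleton.Adj v w)
    (h : G.ArrowheadAt w v) : G.OpenReach X Z w (G.ArrowheadAt v w) := by
  obtain ⟨h', hr, h₁, h₂⟩ := hv
  exact hr.step hvw (fun h _ => h₁ h) fun hn => h₂ fun hh => hn ⟨hh, h⟩

/-- Follow the link edge by edge, repairing the walk by `OpenReach.passable_or` at every vertex;
unless Y is reached, passability survives to the end. -/
theorem Passable.of_colliderLinked (hG : G.IsMVRChainGraph) (hv : G.Passable X Z v)
    (hvw : G.ColliderLinked (G.an (X ∪ Y ∪ Z)) v w) (hvZ : v ∉ Z) (hwZ : w ∉ Z)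
    (hw : w ∈ G.an (X ∪ Y ∪ Z)) :
    G.Passable X Z w ∨ ∃ y ∈ Y, ∃ h', G.OpenReach X Z y h' := by
  obtain ⟨a, ha, b, hb, h₁, h₂⟩ := hvw
  by_contra hcon
  rw [not_or] at hcon
  have hpa : G.Passable X Z a := by
    rcases h₁ with rfl | h₁
    · exact hv
    · obtain ⟨h', hr, h₁', h₂'⟩ := hv
      exact ((hr.step (skeleton_adj_of_dir hG h₁) (fun h _ => h₁' h) fun _ => hvZ).passable_or hG
        ha fun h => absurd (.inl h₁) h).resolve_right hcon.2
  have hpb : G.Passable X Z b := by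
    clear h₂
    induction hb with
    | refl => exact hpa
    | @tail s t _ h ih =>
      exact ((ih.step (skeleton_adj_of_bi h.2.2) (.inr h.2.2.symm)).passable_or hG h.2.1
        fun h' => absurd (.inr h.2.2) h').resolve_right hcon.2
  rcases h₂ with rfl | h₂
  · exact hcon.1 hpb
  · exact not_or.2 hcon ((hpb.step (skeleton_adj_of_dir hG h₂).symm (.inl h₂)).passable_or hG hw
      fun _ => hwZ)

/-- The vertices joined to `X` by a chain of collider links that avoids `Z`. -/
def linkClosure (G : MixedGraph V) (A X Z : Set V) : Set V :=
  {v | ∃ x ∈ X, Relation.ReflTransGen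
    (fun s t => G.ColliderLinked A s t ∧ t ∈ A ∧ t ∉ Z) x v}

theorem subset_linkClosure : X ⊆ G.linkClosure A X Z := fun x hx => ⟨x, hx, .refl⟩

theorem linkClosure_subset (hX : X ⊆ A) (hXZ : Disjoint X Z) : G.linkClosure A X Z ⊆ A \ Z := by
  rintro v ⟨x, hx, h⟩
  induction h with
  | refl => exact ⟨hX hx, Set.disjoint_left.1 hXZ hx⟩
  | tail _ h _ => exact h.2

theorem mSeparated_disjoint_linkClosure (hG : G.IsMVRChainGraph) (hXZ : Disjoint X Z)
    (hYZ : Disjoint Y Z) (h : G.MSeparated X Y Z) :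
    Disjoint (G.linkClosure (G.an (X ∪ Y ∪ Z)) X Z) Y := by
  have hno : ¬ ∃ y ∈ Y, ∃ h', G.OpenReach X Z y h' := by
    rintro ⟨y, hy, h', n, f, hf, h₀, rfl, -⟩
    exact h _ h₀ _ hy (hf.exists_isMConnecting hG rfl rfl (Set.disjoint_left.1 hXZ h₀)
      (Set.disjoint_left.1 hYZ hy))
  refine Set.disjoint_left.2 ?_
  rintro y ⟨x, hx, hxy⟩ hy
  have hp : G.Passable X Z y ∧ y ∉ Z := by
    clear hy
    induction hxy with
    | refl =>
      have hxZ := Set.disjoint_left.1 hXZ hx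
      exact ⟨⟨False, openReach_of_mem hx, False.elim, fun _ => hxZ⟩, hxZ⟩
    | tail _ h ih =>
      exact ⟨(ih.1.of_colliderLinked hG h.1 ih.2 h.2.2 h.2.1).resolve_right hno, h.2.2⟩
  obtain ⟨h', hr, -⟩ := hp.1
  exact hno ⟨y, hy, h', hr⟩

end MixedGraph

variable {V : Type u} {G : MixedGraph V} {I : IndependenceModel V}

open MixedGraph

/-- The closure of X, the set Z and the remaining vertices partition an(X ∪ Y ∪ Z), and no link
joins the first to the last, since it would extend the closure. -/
theorem PartitionMarkov.indep_of_disjoint_linkClosure (hP : PartitionMarkov G I)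
    (hI : IsSemiGraphoid I) {X Y Z : Set V} (hXZ : Disjoint X Z)
    (hYZ : Disjoint Y Z) (h : Disjoint (G.linkClosure (G.an (X ∪ Y ∪ Z)) X Z) Y) :
    Indep I X Y Z := by
  set A := G.an (X ∪ Y ∪ Z) with hA
  set X' := G.linkClosure A X Z with hX'
  have hXA : X ⊆ A := (by intro; simp; tauto : X ⊆ X ∪ Y ∪ Z).trans subset_an
  have hYA : Y ⊆ A := (by intro; simp; tauto : Y ⊆ X ∪ Y ∪ Z).trans subset_an
  have hZA : Z ⊆ A := (by intro; simp; tauto : Z ⊆ X ∪ Y ∪ Z).trans subset_an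
  have hsub : X' ⊆ A \ Z := linkClosure_subset hXA hXZ
  have hu : X' ∪ A \ (X' ∪ Z) ∪ Z = A := by
    ext v
    have := @hsub v
    have := @hZA v
    simp only [Set.mem_union, Set.mem_sdiff] at *
    tauto
  have d₁ : Disjoint X' (A \ (X' ∪ Z)) := Set.disjoint_left.2 fun v hv hv' => hv'.2 (.inl hv)
  have d₂ : Disjoint X' Z := Set.disjoint_left.2 fun v hv hv' => (hsub hv).2 hv'
  have d₃ : Disjoint (A \ (X' ∪ Z)) Z := Set.disjoint_left.2 fun v hv hv' => hv.2 (.inr hv')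
  have key : Indep I X' (A \ (X' ∪ Z)) Z := by
    refine hP _ _ _ (by rw [hu]; exact ancestrallyClosed_an) d₁ d₂ d₃ ?_
    rw [hu]
    rintro u ⟨x, hx, hxu⟩ v ⟨hv, hv'⟩ hl
    rw [Set.mem_union, not_or] at hv'
    exact hv'.1 ⟨x, hx, hxu.tail ⟨hl, hv, hv'.2⟩⟩
  have hYs : Y ⊆ A \ (X' ∪ Z) := fun v hv => by
    refine ⟨hYA hv, ?_⟩
    rintro (hv' | hv')
    · exact Set.disjoint_left.1 h hv' hv
    · exact Set.disjoint_left.1 hYZ hv hv'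
  exact (key.mono_right hI d₁ d₂ d₃ hYs).mono_left hI (d₁.mono_right hYs) d₂ hYZ
    subset_linkClosure

theorem PartitionMarkov.globalMarkov (hP : PartitionMarkov G I) (hI : IsSemiGraphoid I)
    (hG : G.IsMVRChainGraph) : GlobalMarkov G I := fun _ _ _ hX hY _ hXZ hYZ h =>
  hP.indep_of_disjoint_linkClosure hI hXZ hYZ (mSeparated_disjoint_linkClosure hG hXZ hYZ h) hX hY

end MVR

/-! ### The augmented graph, separation by blankets, and the ordered local property -/

namespace MVR

universe u

namespace MixedGraph

variable {V : Type u} {G : MixedGraph V} {A X Y Z : Set V} {a b u v w x y : V}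

theorem IsMVRChainGraph.induce (hG : G.IsMVRChainGraph) (A : Set V) :
    (G.induce A).IsMVRChainGraph := fun u v huv h =>
  hG u v huv (Relation.ReflTransGen.lift (p := fun a b => G.dir a b ∨ G.bi.Adj a b)
    Subtype.val (fun _ _ h => h) v u h)

/-- A path from `x` in the induced graph all of whose inner vertices are colliders ends in the
Markov blanket of `x`. -/
theorem mem_blanket_of_colliderConnected (hG : G.IsMVRChainGraph) {x v : A}
    (hch : ∀ y ∈ A, ¬ G.dir x y) (hxv : x ≠ v) (h : (G.induce A).ColliderConnected x v) :
    (v : V) ∈ G.blanket A x := by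
  obtain ⟨p, -, hc⟩ := h
  -- Only the last vertex can be a parent of the district: an earlier one would be a collider with
  -- an outgoing edge.
  have key : ∀ i ≤ p.length, (p.getVert i : V) ∈ G.biDistrict A x ∨
      i = p.length ∧ (p.getVert i : V) ∈ G.pa (G.biDistrict A x) := by
    intro i
    induction i with
    | zero => exact fun _ => .inl (by rw [p.getVert_zero]; exact mem_biDistrict_self)
    | succ i ih =>
      intro hi
      have hd := (ih (by omega)).resolve_right fun h => by omega
      have hadj := p.adj_getVert_succ (i := i) (by omega)
      have harr : G.ArrowheadAt (p.getVert (i + 1)) (p.getVert i) := by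
        rcases i with _ | i
        · rcases hadj.2 with h | h | h
          · rw [p.getVert_zero] at h
            exact absurd h (hch _ (p.getVert (0 + 1)).2)
          · exact .inl h
          · exact .inr h.symm
        · exact (hc i hi).2
      rcases harr with h | h
      · right
        refine ⟨?_, fun h' => hG.not_reachable h
          (reachable_of_mem_biDistrict (mem_biDistrict_trans (mem_biDistrict_symm h') hd)),
          _, hd, h⟩
        by_contra hne
        exact hG.not_arrowheadAt h (hc i (by omega)).1
      · exact .inl (hd.tail ⟨(p.getVert i).2, (p.getVert (i + 1)).2, h.symm⟩)
  have := key p.length le_rfl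
  rw [p.getVert_length] at this
  rcases this with h | h
  · exact .inr ⟨h, fun e => hxv (Subtype.ext e).symm⟩
  · exact .inl h.2

theorem exists_bi_path {a b : A} (h : (b : V) ∈ G.biDistrict A a) :
    ∃ p : (G.induce A).skeleton.Walk a b, p.IsPath ∧ (∀ i < p.length,
      (G.induce A).bi.Adj (p.getVert i) (p.getVert (i + 1))) ∧
      ∀ v ∈ p.support, (v : V) ∈ G.biDistrict A a := by
  classical
  obtain ⟨q, hq⟩ := (mem_biDistrict_iff_reachable.1 h).exists_isPath
  have hle : G.bi.induce A ≤ (G.induce A).skeleton := fun u v huv =>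
    skeleton_adj_of_bi (G := G.induce A) huv
  refine ⟨q.mapLe hle, (SimpleGraph.Walk.isPath_mapLe hle).2 hq, fun i hi => ?_, fun v hv => ?_⟩
  · simp only [SimpleGraph.Walk.mapLe, SimpleGraph.Walk.length_map,
      SimpleGraph.Walk.getVert_map] at hi ⊢
    exact q.adj_getVert_succ hi
  · rw [SimpleGraph.Walk.support_mapLe_eq_support] at hv
    exact mem_biDistrict_iff_reachable.2 ⟨q.takeUntil v hv⟩

/-- The first edge has an arrowhead at `a`, and the path stays in the district of `a` except
possibly at `v`; this allows a parent of `a` to be prepended. When `v` is a parent, the path is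
built from `v` and reversed. -/
theorem exists_collider_path_of_mem_biDistrict (hG : G.IsMVRChainGraph) {a b v : A}
    (h : (b : V) ∈ G.biDistrict A a) (hv : v = b ∨ G.dir v b) :
    ∃ p : (G.induce A).skeleton.Walk a v, p.IsPath ∧
      (∀ i < p.length, (G.induce A).ArrowheadAt (p.getVert (i + 1)) (p.getVert i)) ∧
      (∀ i, i + 1 < p.length → (G.induce A).ArrowheadAt (p.getVert i) (p.getVert (i + 1))) ∧
      ∀ w ∈ p.support, w = v ∨ (w : V) ∈ G.biDistrict A a := by
  rcases hv with rfl | hv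
  · obtain ⟨p, hp, hbi, hs⟩ := exists_bi_path h
    exact ⟨p, hp, fun i hi => .inr (hbi i hi).symm, fun i hi => .inr (hbi i (by omega)),
      fun w hw => .inr (hs w hw)⟩
  · obtain ⟨q, hq, hbi, hs⟩ := exists_bi_path (mem_biDistrict_symm h)
    have hvq : v ∉ q.support := fun hmem =>
      hG.not_reachable hv (reachable_of_mem_biDistrict (hs v hmem)).symm
    set r := SimpleGraph.Walk.cons (skeleton_adj_of_dir (hG.induce A) (v := b) hv) q with hr
    have hl : r.length = q.length + 1 := rfl
    have h₁ : ∀ i < r.length, (G.induce A).ArrowheadAt (r.getVert i) (r.getVert (i + 1)) := by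
      rintro (_ | i) hi
      · rw [hr, SimpleGraph.Walk.getVert_cons_succ, q.getVert_zero]
        exact .inl hv
      · exact .inr (hbi i (by omega))
    have h₂ : ∀ i, i + 1 < r.length →
        (G.induce A).ArrowheadAt (r.getVert (i + 2)) (r.getVert (i + 1)) :=
      fun i hi => .inr (hbi i (by omega)).symm
    refine ⟨r.reverse, (hq.cons hvq).reverse, fun i hi => ?_, fun i hi => ?_, fun w hw => ?_⟩
    · rw [SimpleGraph.Walk.length_reverse] at hi
      have := h₁ (r.length - (i + 1)) (by omega)
      rw [show r.length - (i + 1) + 1 = r.length - i by omega] at this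
      simpa only [SimpleGraph.Walk.getVert_reverse] using this
    · rw [SimpleGraph.Walk.length_reverse] at hi
      have := h₂ (r.length - (i + 2)) (by omega)
      rw [show r.length - (i + 2) + 2 = r.length - i by omega,
        show r.length - (i + 2) + 1 = r.length - (i + 1) by omega] at this
      simpa only [SimpleGraph.Walk.getVert_reverse] using this
    · rw [SimpleGraph.Walk.support_reverse, List.mem_reverse, hr,
        SimpleGraph.Walk.support_cons, List.mem_cons] at hw
      exact hw.imp id fun hw => mem_biDistrict_trans h (hs w hw)

theorem colliderConnected_of_colliderLinked (hG : G.IsMVRChainGraph) {u v : A} (huv : u ≠ v)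
    (h : G.ColliderLinked A u v) : (G.induce A).ColliderConnected u v := by
  obtain ⟨a, ha, b, hb, hu, hv⟩ := h
  obtain ⟨p, hp, h₁, h₂, hs⟩ := exists_collider_path_of_mem_biDistrict hG (a := ⟨a, ha⟩)
    (b := ⟨b, biDistrict_subset ha hb⟩) (v := v) hb (hv.imp Subtype.ext id)
  rcases hu with hu | hu
  · obtain rfl : u = ⟨a, ha⟩ := Subtype.ext hu
    exact ⟨p, hp, fun i hi => ⟨h₂ i (by omega), h₁ (i + 1) (by omega)⟩⟩
  · have hup : u ∉ p.support := fun hmem => by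
      rcases hs u hmem with h | h
      · exact huv h
      · exact hG.not_reachable hu (reachable_of_mem_biDistrict h).symm
    refine ⟨.cons (skeleton_adj_of_dir (hG.induce A) (u := u) (v := ⟨a, ha⟩) hu) p, hp.cons hup, ?_⟩
    rintro (_ | i) hi
    · rw [SimpleGraph.Walk.length_cons] at hi
      have := h₁ 0 (by omega)
      rw [p.getVert_zero] at this
      constructor
      · rw [SimpleGraph.Walk.getVert_cons_succ, p.getVert_zero]
        exact .inl hu
      · rw [SimpleGraph.Walk.getVert_cons_succ, SimpleGraph.Walk.getVert_cons_succ, p.getVert_zero]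
        exact this
    · rw [SimpleGraph.Walk.length_cons] at hi
      exact ⟨h₂ i (by omega), h₁ (i + 1) (by omega)⟩

/-- A chain of links becomes a walk in the augmented graph that avoids Z; loops are skipped, because
a vertex may be linked to itself. -/
theorem mStarSeparated_disjoint_linkClosure (hG : G.IsMVRChainGraph) (hXZ : Disjoint X Z)
    (h : G.MStarSeparated X Y Z) : Disjoint (G.linkClosure (G.an (X ∪ Y ∪ Z)) X Z) Y := by
  unfold MStarSeparated at h
  have hXA : X ⊆ G.an (X ∪ Y ∪ Z) := (by intro; simp; tauto : X ⊆ X ∪ Y ∪ Z).trans subset_an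
  generalize G.an (X ∪ Y ∪ Z) = A at *
  refine Set.disjoint_left.2 ?_
  rintro y ⟨x, hx, hxy⟩ hy
  have key : ∃ hyA : y ∈ A, ∃ p : (G.induce A).augmented.Walk ⟨x, hXA hx⟩ ⟨y, hyA⟩,
      ∀ z ∈ p.support, (z : V) ∉ Z := by
    clear hy
    induction hxy with
    | refl =>
      refine ⟨hXA hx, .nil, fun z hz => ?_⟩
      rw [SimpleGraph.Walk.support_nil, List.mem_singleton] at hz
      subst hz
      exact Set.disjoint_left.1 hXZ hx
    | @tail s t _ hst ih =>
      obtain ⟨hs, p, hp⟩ := ih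
      obtain ⟨hl, ht, htZ⟩ := hst
      refine ⟨ht, ?_⟩
      by_cases he : s = t
      · subst he
        exact ⟨p, hp⟩
      · have hne : (⟨s, hs⟩ : A) ≠ ⟨t, ht⟩ := fun h => he (congrArg Subtype.val h)
        have hadj : (G.induce A).augmented.Adj ⟨s, hs⟩ ⟨t, ht⟩ :=
          ⟨hne, colliderConnected_of_colliderLinked hG hne hl⟩
        refine ⟨p.concat hadj, fun z hz => ?_⟩
        rw [SimpleGraph.Walk.support_concat, List.mem_append, List.mem_singleton] at hz
        rcases hz with hz | rfl
        · exact hp z hz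
        · exact htZ
  obtain ⟨hyA, p, hp⟩ := key
  classical
  obtain ⟨z, hz, hzZ⟩ := h ⟨x, hXA hx⟩ hx ⟨y, hyA⟩ hy p.bypass p.bypass_isPath
  exact hp z (p.support_bypass_subset_support hz) hzZ

theorem isOpenSeq_getVert {p : G.skeleton.Walk a b} (hp : G.IsMConnecting p Z) :
    G.IsOpenSeq Z p.length p.getVert :=
  ⟨fun _ hi => p.adj_getVert_succ hi, hp.2.2.2⟩

/-- A childless vertex is m-separated from the other vertices given its Markov blanket. -/
theorem mSeparated_blanket (hG : G.IsMVRChainGraph) (hA : G.AncestrallyClosed A) (hx : x ∈ A)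
    (hch : ∀ y ∈ A, ¬ G.dir x y) :
    G.MSeparated {x} (A \ (G.blanket A x ∪ {x})) (G.blanket A x) := by
  rintro a rfl b ⟨hbA, hb⟩ ⟨p, hp⟩
  rw [Set.mem_union, not_or] at hb
  have hpA : ∀ i ≤ p.length, p.getVert i ∈ A := by
    intro i hi
    have := (isOpenSeq_getVert hp).mem_an (X := A) (Y := A) (by rwa [p.getVert_zero])
      (by rwa [p.getVert_length]) hi
    rwa [Set.union_self, Set.union_eq_self_of_subset_right (blanket_subset hA hx),
      show G.an A = A from hA] at this
  -- An m-connecting path would never leave the district of the start. Inner district vertices are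
  -- in the blanket and so must be colliders, and the start is childless; thus each next edge points
  -- back. If it were directed, its source would be a blanket vertex that is a noncollider or the
  -- endpoint.
  have key : ∀ i ≤ p.length, p.getVert i ∈ G.biDistrict A a := by
    intro i
    induction i with
    | zero => exact fun _ => by rw [p.getVert_zero]; exact mem_biDistrict_self
    | succ i ih =>
      intro hi
      have hd := ih (by omega)
      have hadj := p.adj_getVert_succ (i := i) (by omega)
      have harr : G.ArrowheadAt (p.getVert (i + 1)) (p.getVert i) := by
        rcases i with _ | i
        · by_contra hn
          have := dir_of_adj_of_not_arrowheadAt hadj hn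
          rw [p.getVert_zero] at this
          exact hch _ (hpA _ hi) this
        · by_contra hn
          refine (hp.2.2.2 i hi).2 (fun hc => hn hc.2) (.inr ⟨hd, fun he => ?_⟩)
          have := hp.1.getVert_injOn (x₁ := i + 1) (x₂ := 0) (show i + 1 ≤ p.length by omega)
            (Nat.zero_le _) (by rw [p.getVert_zero]; exact he)
          omega
      rcases harr with h | h
      · have hpa : p.getVert (i + 1) ∈ G.blanket A a :=
          .inl ⟨fun h' => hG.not_reachable h
            (reachable_of_mem_biDistrict (mem_biDistrict_trans (mem_biDistrict_symm h') hd)),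
            _, hd, h⟩
        rcases hi.eq_or_lt with he | hlt
        · rw [he, p.getVert_length] at hpa
          exact absurd hpa hb.1
        · exact absurd hpa ((hp.2.2.2 i hlt).2 fun hc => hG.not_arrowheadAt h hc.1)
      · exact hd.tail ⟨hpA i (by omega), hpA _ hi, h.symm⟩
  have := key p.length le_rfl
  rw [p.getVert_length] at this
  exact hb.1 (.inr ⟨this, hb.2⟩)

theorem an_union_eq (hA : G.AncestrallyClosed A) (hx : x ∈ A) :
    G.an ({x} ∪ A \ (G.blanket A x ∪ {x}) ∪ G.blanket A x) = A := by
  have h : {x} ∪ A \ (G.blanket A x ∪ {x}) ∪ G.blanket A x = A := by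
    ext v
    have := @blanket_subset _ _ _ _ hA hx v
    simp only [Set.mem_union, Set.mem_sdiff, Set.mem_singleton_iff]
    grind
  rw [h]
  exact hA

/-- All neighbours of `x` in the augmented graph lie in the blanket, so the second vertex of any
path already blocks it. -/
theorem mStarSeparated_blanket (hG : G.IsMVRChainGraph) (hA : G.AncestrallyClosed A) (hx : x ∈ A)
    (hch : ∀ y ∈ A, ¬ G.dir x y) :
    G.MStarSeparated {x} (A \ (G.blanket A x ∪ {x})) (G.blanket A x) := by
  unfold MStarSeparated
  rw [an_union_eq hA hx]
  rintro ⟨_, hx'⟩ rfl ⟨y, hyA⟩ ⟨-, hy⟩ p -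
  cases p with
  | nil => exact absurd (.inr rfl) hy
  | @cons _ v _ h q =>
    exact ⟨v, by simp, mem_blanket_of_colliderConnected hG hch h.1 h.2⟩

end MixedGraph

open MixedGraph

variable {V : Type u} {G : MixedGraph V} {I : IndependenceModel V}

theorem PartitionMarkov.augmentedGlobalMarkov (hP : PartitionMarkov G I) (hI : IsSemiGraphoid I)
    (hG : G.IsMVRChainGraph) : AugmentedGlobalMarkov G I := fun _ _ _ hX hY _ hXZ hYZ h =>
  hP.indep_of_disjoint_linkClosure hI hXZ hYZ (mStarSeparated_disjoint_linkClosure hG hXZ h) hX hY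

variable {lt : V → V → Prop}

theorem MixedGraph.IsConsistentVertexOrder.not_dir (hG : G.IsMVRChainGraph)
    (hlt : G.IsConsistentVertexOrder lt) {x y : V} (h : lt y x ∨ y = x) : ¬ G.dir x y := by
  rintro hd
  rcases h with h | rfl
  · exact hlt.consistent y x h ⟨y, rfl, .single hd⟩
  · exact hG _ _ hd .refl

theorem OrderedLocalMarkov.partitionMarkov [Finite V] (hM : OrderedLocalMarkov G lt I)
    (hI : IsSemiGraphoid I) (hG : G.IsMVRChainGraph) (hlt : G.IsConsistentVertexOrder lt) :
    PartitionMarkov G I := by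
  refine partitionMarkov_of_local hI fun A hA hne => ?_
  have := hlt.isStrictTotalOrder
  -- Reversing the order yields the last vertex of A, which has no children in A.
  have hwf : WellFounded (Function.swap lt) := Finite.wellFounded_of_trans_of_irrefl _
  obtain ⟨x, hx, hmax⟩ := hwf.has_min A hne
  have hle : ∀ y ∈ A, lt y x ∨ y = x := fun y hy => by
    rcases trichotomous_of lt y x with h | h | h
    · exact .inl h
    · exact .inr h
    · exact absurd h (hmax y hy)
  refine ⟨x, hx, fun y hy => hlt.not_dir hG (hle y hy), ?_⟩
  have := hM A ⟨x, hx⟩ hA hle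
  rwa [mb_eq_blanket] at this

theorem orderedLocalMarkov_of_blanket (hG : G.IsMVRChainGraph)
    (hlt : G.IsConsistentVertexOrder lt)
    (H : ∀ A : Set V, ∀ x ∈ A, G.AncestrallyClosed A → (∀ y ∈ A, ¬ G.dir x y) →
      Indep I {x} (A \ (G.blanket A x ∪ {x})) (G.blanket A x)) : OrderedLocalMarkov G lt I := by
  intro A x hA hle
  rw [mb_eq_blanket]
  exact H A x x.2 hA fun y hy => hlt.not_dir hG (hle hy)

theorem disjoint_blanket {A : Set V} {x : V} : Disjoint {x} (A \ (G.blanket A x ∪ {x})) ∧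
    Disjoint {x} (G.blanket A x) ∧ Disjoint (A \ (G.blanket A x ∪ {x})) (G.blanket A x) :=
  ⟨by simp, by simpa using notMem_blanket_self,
    Set.disjoint_left.2 fun _ hv hv' => hv.2 (.inl hv')⟩

theorem GlobalMarkov.orderedLocalMarkov (hM : GlobalMarkov G I) (hG : G.IsMVRChainGraph)
    (hlt : G.IsConsistentVertexOrder lt) : OrderedLocalMarkov G lt I :=
  orderedLocalMarkov_of_blanket hG hlt fun _ _ hx hA hch hne hne' =>
    hM _ _ _ hne hne' disjoint_blanket.1 disjoint_blanket.2.1 disjoint_blanket.2.2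
      (mSeparated_blanket hG hA hx hch)

theorem AugmentedGlobalMarkov.orderedLocalMarkov (hM : AugmentedGlobalMarkov G I)
    (hG : G.IsMVRChainGraph) (hlt : G.IsConsistentVertexOrder lt) : OrderedLocalMarkov G lt I :=
  orderedLocalMarkov_of_blanket hG hlt fun _ _ hx hA hch hne hne' =>
    hM _ _ _ hne hne' disjoint_blanket.1 disjoint_blanket.2.1 disjoint_blanket.2.2
      (mStarSeparated_blanket hG hA hx hch)

end MVR

theorem theorem2 {V : Type*} [Finite V] (G : MVR.MixedGraph V) (hG : G.IsMVRChainGraph)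
    (compLt : G.ChainComponent → G.ChainComponent → Prop)
    (hcomp : G.IsConsistentCompOrder compLt)
    (vertLt : V → V → Prop) (hvert : G.IsConsistentVertexOrder vertLt)
    (I : MVR.IndependenceModel V) (hI : MVR.IsSemiGraphoid I) :
    List.TFAE
      [MVR.GlobalMarkov G I,
       MVR.AugmentedGlobalMarkov G I,
       MVR.BlockRecursiveMarkov G I,
       MVR.MRMarkov G compLt I,
       MVR.OrderedLocalMarkov G vertLt I] := by
  tfae_have 1 → 5 := fun h => h.orderedLocalMarkov hG hvert
  tfae_have 2 → 5 := fun h => h.orderedLocalMarkov hG hvert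
  tfae_have 5 → 3 := fun h => (h.partitionMarkov hI hG hvert).blockRecursive hG hcomp hI
  tfae_have 3 → 4 := fun h => (h.partitionMarkov hI hG hcomp).mrMarkov hG hcomp
  tfae_have 4 → 1 := fun h => (h.partitionMarkov hI hG hcomp).globalMarkov hI hG
  tfae_have 4 → 2 := fun h => (h.partitionMarkov hI hG hcomp).augmentedGlobalMarkov hI hG
  tfae_finish
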